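/- **Definitions.** Let $f$ be a probability density on $\mathbb R$ with distribution function $F$. Maxima and minima are counted together as local extremes. A density has *at most $m$ local extremes* if, for some $l\le m$ and points $s_1\le\dots\le s_l$, it is alternately nondecreasing, nonincreasing, nondecreasing, … on the consecutive open intervals $(-\infty,s_1),(s_1,s_2),\dots,(s_l,\infty)$. The density $f$ is *$k$-modal with extremes at $t_1^e<\dots<t_k^e$* if it is alternately nondecreasing, nonincreasing, … on the consecutive open intervals cut out by these points, and each extreme sits at a single point: if $t_i^e$ is a maximum (minimum), then every value $f(x)$ with $x\neq t_i^e$ close to $t_i^e$ is strictly smaller (larger) than some values $f(y)$ with $y\ne t_i^e$ arbitrarily close to $t_i^e$. (If $f$ is continuous at $t_i^e$, this says that $t_i^e$ is a strict local extremum.) For a sample of size $n$ with empirical distribution function $F_n$ and smallest and largest observations $x_{(1)},x_{(n)}$, the *taut string* $S_n^C$ is the function with the shortest graph among the continuous nondecreasing functions $S$ on $[x_{(1)},x_{(n)}]$ with $S(x_{(1)})=0$, $S(x_{(n)})=1$ and $|S-F_n|\le C/\sqrt n$ on $[x_{(1)},x_{(n)}]$. Its density $s_n^C$ is its left-hand derivative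 on $(x_{(1)},x_{(n)}]$, its right-hand derivative at $x_{(1)}$, and $0$ off $[x_{(1)},x_{(n)}]$. An *extreme interval* of $s_n^C$ is a bounded interval on which $s_n^C$ is constant and such that $s_n^C$ is strictly smaller at all nearby points off the interval, or strictly larger at all of them. Let $k_n^C$ be the number of extreme intervals, $I_i^e(n,C)$, $1\le i\le k_n^C$, these intervals from left to right, $t_i^e(n,C)$ their midpoints, and $|I|$ the length of $I$. **Theorem 4.1.** Let $X_1,X_2,\dots$ be i.i.d. with density $f$, where $f$ is $k$-modal with extremes at $t_1^e<\dots<t_k^e$, and suppose that $$\inf_{G}\ \sup_{x\in\mathbb R}|F(x)-G(x)|>0,$$ the infimum being over the distribution functions $G$ of densities with at most $k-1$ local extremes (an infimum over the empty set is $+\infty$). Form $S_n^C$ from $X_1,\dots,X_n$. Then for all $\delta>0$, $$\lim_{C\to\infty}\liminf_{n\to\infty}\mathbb P\Big(\{k_n^C=k\}\cap\Big\{\max_{1\le i\le k_n^C}|I_i^e(n,C)|\le\delta\Big\}\cap\Big\{\max_{1\le i\le k_n^C}|t_i^e(n,C)-t_i^e|\le\delta\Big\}\Big)=1,$$ where the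 event includes the existence of the taut string and $\mathbb P$ is read as inner probability (the ordinary probability when the event is measurable). -/

import Mathlib

open MeasureTheory ProbabilityTheory Filter Topology Set

noncomputable section

namespace TautString

/-! ### Densities, distribution functions, Kolmogorov distance -/

/-- `f` is a probability density on the real line. -/
structure IsDensity (f : ℝ → ℝ) : Prop where
  measurable : Measurable f
  nonneg : ∀ x, 0 ≤ f x
  lintegral_eq_one : ∫⁻ x, ENNReal.ofReal (f x) = 1

/-- The distribution function of the density `f`. -/
def distFun (f : ℝ → ℝ) (x : ℝ) : ℝ := ∫ y in Iic x, f y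

/-- The Kolmogorov (supremum) distance of two distribution functions. -/
def kolmogorovDist (F G : ℝ → ℝ) : ℝ := ⨆ x, |F x - G x|

/-! ### Modality of a density on the real line -/

/-- The `j`-th of the `k + 1` open intervals into which `t 0 ≤ … ≤ t (k-1)` cut the line
(`j = 0, …, k`; it is empty when its two endpoints coincide). -/
def piece {k : ℕ} (t : Fin k → ℝ) (j : Fin (k + 1)) : Set ℝ :=
  {x | ∀ i : Fin k, ((i : ℕ) < (j : ℕ) → t i < x) ∧ ((j : ℕ) ≤ (i : ℕ) → x < t i)}

/-- `f` is alternately nondecreasing, nonincreasing, nondecreasing, … on the consecutive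
intervals cut out by the points `t`, starting with nondecreasing at `-∞` (no restriction for a
density on the line). The values of `f` at the points of `t` themselves play no role. -/
def Alternates {k : ℕ} (f : ℝ → ℝ) (t : Fin k → ℝ) : Prop :=
  ∀ j : Fin (k + 1),
    (Even (j : ℕ) → MonotoneOn f (piece t j)) ∧ (Odd (j : ℕ) → AntitoneOn f (piece t j))

/-- `f` has at most `m` local extremes (maxima and minima counted together). -/
def AtMostModal (m : ℕ) (f : ℝ → ℝ) : Prop :=
  ∃ l ≤ m, ∃ t : Fin l → ℝ, Monotone t ∧ Alternates f t

/-- `f` is `k`-modal with its `k` local extremes (maxima and minima counted together, in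
alternation) at the points `t 0 < … < t (k-1)`, each extreme being located at a single point:
every value `f x` with `x ≠ t i` near `t i` is strictly exceeded (at a maximum), respectively
strictly undercut (at a minimum), by values of `f` arbitrarily near `t i`. For `f` continuous at
`t i` this says that `t i` is a strict local maximum, respectively minimum; the formulation also
covers extremes at jumps and at poles of `f`, and it ignores the value of the density at the
single point `t i`. -/
structure IsModal {k : ℕ} (f : ℝ → ℝ) (t : Fin k → ℝ) : Prop where
  strictMono : StrictMono t
  alternates : Alternates f t
  isolated_max : ∀ i : Fin k, Even (i : ℕ) →
    ∀ᶠ x in 𝓝[≠] t i, ∃ᶠ y in 𝓝[≠] t i, f x < f y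
  isolated_min : ∀ i : Fin k, Odd (i : ℕ) →
    ∀ᶠ x in 𝓝[≠] t i, ∃ᶠ y in 𝓝[≠] t i, f y < f x

/-! ### Empirical distribution and taut string -/

/-- The empirical distribution function of the sample `x`. -/
def empCDF {n : ℕ} (x : Fin n → ℝ) (y : ℝ) : ℝ :=
  ((Finset.univ.filter fun i => x i ≤ y).card : ℝ) / n

/-- The smallest observation. -/
def sampleMin {n : ℕ} (x : Fin n → ℝ) : ℝ := ⨅ i, x i

/-- The largest observation. -/
def sampleMax {n : ℕ} (x : Fin n → ℝ) : ℝ := ⨆ i, x i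

/-- The length of the graph of `S` over `[a, b]` in the Euclidean plane. -/
def graphLength (a b : ℝ) (S : ℝ → ℝ) : ENNReal :=
  eVariationOn (fun y : ℝ => WithLp.toLp 2 (y, S y)) (Icc a b)

/-- `S`, as a function on the interval between the extreme observations, is a continuous string
in the Kolmogorov tube of radius `ε` about the empirical distribution function, running from `0`
at the smallest to `1` at the largest observation. -/
structure IsTubeString {n : ℕ} (x : Fin n → ℝ) (ε : ℝ) (S : ℝ → ℝ) : Prop where
  continuousOn : ContinuousOn S (Icc (sampleMin x) (sampleMax x))
  monotoneOn : MonotoneOn S (Icc (sampleMin x) (sampleMax x))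
  mem_tube : ∀ y ∈ Icc (sampleMin x) (sampleMax x), |S y - empCDF x y| ≤ ε
  left_eq : S (sampleMin x) = 0
  right_eq : S (sampleMax x) = 1

/-- `S` is the taut string: the shortest string in the tube. -/
def IsTautString {n : ℕ} (x : Fin n → ℝ) (ε : ℝ) (S : ℝ → ℝ) : Prop :=
  IsTubeString x ε S ∧
    ∀ T, IsTubeString x ε T →
      graphLength (sampleMin x) (sampleMax x) S ≤ graphLength (sampleMin x) (sampleMax x) T

/-- The density of the string `S` on `[a, b]`, as a function on the line: the left-hand derivative
on `(a, b]`, the right-hand derivative at `a`, and `0` off `[a, b]`. -/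
def stringDensity (a b : ℝ) (S : ℝ → ℝ) (y : ℝ) : ℝ :=
  if a < y ∧ y ≤ b then derivWithin S (Iic y) y
  else if y = a then derivWithin S (Ici y) y
  else 0

/-! ### Extreme intervals of a piecewise constant function -/

/-- `A` is a bounded interval on which `s` is constant, and `s` is strictly smaller at the points
off `A` close to `A`. -/
def IsLocalMaxInterval (s : ℝ → ℝ) (A : Set ℝ) : Prop :=
  A.Nonempty ∧ A.OrdConnected ∧ Bornology.IsBounded A ∧
    ∃ c, (∀ x ∈ A, s x = c) ∧ ∃ η > 0, ∀ x ∈ Metric.thickening η A, x ∉ A → s x < c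

/-- `A` is a bounded interval on which `s` is constant, and `s` is strictly larger at the points
off `A` close to `A`. -/
def IsLocalMinInterval (s : ℝ → ℝ) (A : Set ℝ) : Prop :=
  A.Nonempty ∧ A.OrdConnected ∧ Bornology.IsBounded A ∧
    ∃ c, (∀ x ∈ A, s x = c) ∧ ∃ η > 0, ∀ x ∈ Metric.thickening η A, x ∉ A → c < s x

/-- The intervals on which `s` takes its local extreme values. -/
def extremeIntervals (s : ℝ → ℝ) : Set (Set ℝ) :=
  {A | IsLocalMaxInterval s A ∨ IsLocalMinInterval s A}

/-- The modality of a piecewise constant function: the number of its extreme intervals. -/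
def modality (s : ℝ → ℝ) : ℕ∞ := (extremeIntervals s).encard

/-- The length of a bounded interval. -/
def intervalLength (A : Set ℝ) : ℝ := sSup A - sInf A

/-- The midpoint of a bounded interval. -/
def intervalMid (A : Set ℝ) : ℝ := (sInf A + sSup A) / 2

/-- `s` has exactly `k` extreme intervals, all of length at most `δ`, and the midpoint of the
`i`-th one, counted from the left, is within `δ` of `t i`. -/
def LocatesExtremes {k : ℕ} (s : ℝ → ℝ) (t : Fin k → ℝ) (δ : ℝ) : Prop :=
  modality s = k ∧
  (∀ A ∈ extremeIntervals s, intervalLength A ≤ δ) ∧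
  ∃ I : Fin k → Set ℝ,
    (∀ i j, i < j → ∀ x ∈ I i, ∀ y ∈ I j, x < y) ∧
    range I = extremeIntervals s ∧
    ∀ i, |intervalMid (I i) - t i| ≤ δ

/-- The taut string in the tube of radius `ε` about the sample `x` exists, and its density has
exactly `k` extreme intervals, which are short and close to the points `t`. (Two taut strings can
differ only off the interval between the extreme observations, which does not affect the
density.) -/
def TautStringLocates {n k : ℕ} (x : Fin n → ℝ) (ε : ℝ) (t : Fin k → ℝ) (δ : ℝ) : Prop :=
  (∃ S, IsTautString x ε S) ∧
    ∀ S, IsTautString x ε S →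
      LocatesExtremes (stringDensity (sampleMin x) (sampleMax x) S) t δ

/-- The inner probability of an event: its probability if it is measurable. -/
def innerProb {Ω : Type*} [MeasurableSpace Ω] (P : Measure Ω) (A : Set Ω) : ENNReal :=
  1 - P Aᶜ

end TautString

end

/-!
For small `ε`, suppose that the empirical distribution function `F_n` is within `ε / 4` of the
distribution function `F` of `f`, where `ε` is the radius of the tube. Then the taut string
locates the extremes of `f`, for a deterministic reason (`eventually_tautStringLocates`).

A taut string is affine wherever its chord stays in the tube (`IsTautString.eq_chord`, by strict
convexity of the Euclidean plane). Hence it is a polygon, it touches the upper boundary of the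
tube where it bends upwards and the lower boundary where it bends downwards
(`IsTautString.kink`). Unless the string is a single segment, it therefore rises by less than
`F` does over a locally maximal piece, and by more over a locally minimal one:
the averages of `f` over the successive extreme pieces strictly alternate. A density that is
alternately monotone on `k + 1` intervals, nondecreasing first, has room for at most `k` such
pieces (`IsTautShape.card_extremeIndices_le`).

Conversely, since each extreme of `f` sits at a single point, `f` has near a maximum `t i` an
average over a short interval that strictly exceeds its averages over short intervals on both
sides, all inside a given neighbourhood of `t i` (`hasBump_of_isolated`); likewise at a minimum.
The string is uniformly close to `F`, so its slopes inherit this pattern, and one of its extreme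
pieces lies in that neighbourhood (`IsTautShape.exists_extreme_of_bump`). The neighbourhoods are
disjoint, so these `k` pieces are all the extreme pieces.

Existence of the taut string follows by minimizing the length, which is lower semicontinuous,
over the compact family of polygons in the tube with vertices at observations
(`exists_isTautString`).

The probabilistic input is the tightness of `√n ‖F_n - F‖` (`measure_empCDF_deviation_le`): with
the probability integral transform the problem is reduced to the uniform distribution, where
fourth moments of increments and dyadic chaining give a bound that does not depend on `n`.
-/

noncomputable section

namespace TautString

/-! ### Tightness of the Kolmogorov–Smirnov statistic -/

section Moments

variable {Ω : Type*}

theorem abs_sum_range_le {Y : ℕ → Ω → ℝ} (hb : ∀ i ω, |Y i ω| ≤ 1) (n : ℕ) (ω : Ω) :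
    |∑ i ∈ Finset.range n, Y i ω| ≤ n := by
  refine (Finset.abs_sum_le_sum_abs _ _).trans ?_
  simpa using Finset.sum_le_sum fun i (_ : i ∈ Finset.range n) => hb i ω

variable [MeasurableSpace Ω] {P : Measure Ω}

theorem integral_pow_mul_pow {S Y : Ω → ℝ} (h : IndepFun S Y P) (hS : Measurable S)
    (hY : Measurable Y) (i j : ℕ) :
    ∫ ω, S ω ^ i * Y ω ^ j ∂P = (∫ ω, S ω ^ i ∂P) * ∫ ω, Y ω ^ j ∂P :=
  (h.comp (measurable_id.pow_const i) (measurable_id.pow_const j)).integral_fun_mul_eq_mul_integral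
    (hS.pow_const i).aestronglyMeasurable (hY.pow_const j).aestronglyMeasurable

variable [IsProbabilityMeasure P]

theorem integrable_of_abs_le {Y : Ω → ℝ} (hY : Measurable Y) (c : ℝ) (h : ∀ ω, |Y ω| ≤ c) :
    Integrable Y P :=
  Integrable.of_bound hY.aestronglyMeasurable c (ae_of_all _ fun ω => by simpa using h ω)

/-- Sums of independent centred variables bounded by `1` with variances at most `p` have fourth
moments of the order `n p + n² p²`. -/
theorem moments_sum_le {Y : ℕ → Ω → ℝ} (hY : ∀ i, Measurable (Y i)) (hind : iIndepFun Y P)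
    (hb : ∀ i ω, |Y i ω| ≤ 1) (h0 : ∀ i, ∫ ω, Y i ω ∂P = 0) {p : ℝ} (hp : 0 ≤ p)
    (hv : ∀ i, ∫ ω, Y i ω ^ 2 ∂P ≤ p) (n : ℕ) :
    ∫ ω, (∑ i ∈ Finset.range n, Y i ω) ∂P = 0 ∧
    ∫ ω, (∑ i ∈ Finset.range n, Y i ω) ^ 2 ∂P ≤ n * p ∧
    ∫ ω, (∑ i ∈ Finset.range n, Y i ω) ^ 4 ∂P ≤ n * p + 3 * n ^ 2 * p ^ 2 := by
  induction n with
  | zero => simp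
  | succ n ih =>
    obtain ⟨ih1, ih2, ih4⟩ := ih
    set S : Ω → ℝ := fun ω => ∑ i ∈ Finset.range n, Y i ω with hS
    have hSm : Measurable S := Finset.measurable_sum _ fun i _ => hY i
    have hSb : ∀ ω, |S ω| ≤ n := abs_sum_range_le hb n
    have hSY : IndepFun S (Y n) P := by
      have := hind.indepFun_finsetSum_of_notMem (s := Finset.range n) (i := n) hY (by simp)
      convert this using 1
      ext ω; simp [hS]
    have hint : ∀ i j, Integrable (fun ω => S ω ^ i * Y n ω ^ j) P := fun i j => by
      refine integrable_of_abs_le ((hSm.pow_const i).mul ((hY n).pow_const j)) ((n : ℝ) ^ i) ?_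
      intro ω
      rw [abs_mul, abs_pow, abs_pow]
      calc |S ω| ^ i * |Y n ω| ^ j ≤ (n : ℝ) ^ i * 1 := by
            gcongr
            · exact hSb ω
            · exact pow_le_one₀ (abs_nonneg _) (hb n ω)
        _ = _ := mul_one _
    have hY4 : ∫ ω, Y n ω ^ 4 ∂P ≤ p := by
      refine le_trans (integral_mono ?_ ?_ fun ω => ?_) (hv n)
      · simpa using hint 0 4
      · simpa using hint 0 2
      · have h1 : Y n ω ^ 2 ≤ 1 := (sq_le_one_iff_abs_le_one _).2 (hb n ω)
        simp only
        nlinarith [sq_nonneg (Y n ω)]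
    have hprod := fun i j => integral_pow_mul_pow hSY hSm (hY n) i j
    have h10 := hint 1 0
    have h01 := hint 0 1
    have p11 := hprod 1 1
    have p31 := hprod 3 1
    have p13 := hprod 1 3
    have p22 := hprod 2 2
    have h20 := hint 2 0
    have h02 := hint 0 2
    have h40 := hint 4 0
    have h04 := hint 0 4
    simp only [pow_zero, mul_one, one_mul, pow_one] at h10 h01 p11 p31 p13 h20 h02 h40 h04
    rw [h0 n, mul_zero] at p11 p31
    rw [ih1, zero_mul] at p13
    have h11 := hint 1 1
    have h31 := hint 3 1
    have h13 := hint 1 3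
    simp only [pow_one] at h11 h31 h13
    refine ⟨?_, ?_, ?_⟩
    · simp_rw [Finset.sum_range_succ]
      rw [integral_add h10 h01, ih1, h0 n, add_zero]
    · have : ∀ ω, (∑ i ∈ Finset.range (n + 1), Y i ω) ^ 2
          = S ω ^ 2 + 2 * (S ω * Y n ω) + Y n ω ^ 2 := fun ω => by
        rw [Finset.sum_range_succ]; ring
      simp_rw [this]
      have a1 : Integrable (fun ω => S ω ^ 2 + 2 * (S ω * Y n ω)) P := h20.add (h11.const_mul 2)
      rw [integral_add a1 h02, integral_add h20 (h11.const_mul 2), integral_const_mul, p11]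
      push_cast
      linarith [hv n]
    · have : ∀ ω, (∑ i ∈ Finset.range (n + 1), Y i ω) ^ 4
          = S ω ^ 4 + 4 * (S ω ^ 3 * Y n ω) + 6 * (S ω ^ 2 * Y n ω ^ 2) + 4 * (S ω * Y n ω ^ 3)
            + Y n ω ^ 4 := fun ω => by
        rw [Finset.sum_range_succ]; ring
      simp_rw [this]
      have a1 : Integrable (fun ω => S ω ^ 4 + 4 * (S ω ^ 3 * Y n ω)) P :=
        h40.add (h31.const_mul 4)
      have a2 : Integrable (fun ω => S ω ^ 4 + 4 * (S ω ^ 3 * Y n ω)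
          + 6 * (S ω ^ 2 * Y n ω ^ 2)) P := a1.add ((hint 2 2).const_mul 6)
      have a3 : Integrable (fun ω => S ω ^ 4 + 4 * (S ω ^ 3 * Y n ω)
          + 6 * (S ω ^ 2 * Y n ω ^ 2) + 4 * (S ω * Y n ω ^ 3)) P := a2.add (h13.const_mul 4)
      rw [integral_add a3 h04, integral_add a2 (h13.const_mul 4),
        integral_add a1 ((hint 2 2).const_mul 6), integral_add h40 (h31.const_mul 4)]
      simp_rw [integral_const_mul]
      rw [p31, p13, p22]
      have hSS : (∫ ω, S ω ^ 2 ∂P) * ∫ ω, Y n ω ^ 2 ∂P ≤ (n * p) * p :=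
        mul_le_mul ih2 (hv n) (integral_nonneg fun ω => sq_nonneg _) (by positivity)
      push_cast
      nlinarith [sq_nonneg p]

/-- Markov's inequality for the fourth power of the sums in `moments_sum_le`. -/
theorem measure_abs_sum_gt_le {Y : ℕ → Ω → ℝ} (hY : ∀ i, Measurable (Y i)) (hind : iIndepFun Y P)
    (hb : ∀ i ω, |Y i ω| ≤ 1) (h0 : ∀ i, ∫ ω, Y i ω ∂P = 0) {p : ℝ} (hp : 0 ≤ p)
    (hv : ∀ i, ∫ ω, Y i ω ^ 2 ∂P ≤ p) (n : ℕ) {c : ℝ} (hc : 0 < c) :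
    P {ω | c < |∑ i ∈ Finset.range n, Y i ω|}
      ≤ ENNReal.ofReal ((n * p + 3 * n ^ 2 * p ^ 2) / c ^ 4) := by
  have hm := (moments_sum_le hY hind hb h0 hp hv n).2.2
  have hSm : Measurable fun ω => ∑ i ∈ Finset.range n, Y i ω :=
    Finset.measurable_sum _ fun i _ => hY i
  have hmark := mul_meas_ge_le_integral_of_nonneg (μ := P)
    (f := fun ω => (∑ i ∈ Finset.range n, Y i ω) ^ 4)
    (ae_of_all _ fun ω => by positivity)
    (integrable_of_abs_le (hSm.pow_const 4) ((n : ℝ) ^ 4) fun ω => by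
      rw [abs_pow]; exact pow_le_pow_left₀ (abs_nonneg _) (abs_sum_range_le hb n ω) 4) (c ^ 4)
  have hsub : {ω | c < |∑ i ∈ Finset.range n, Y i ω|}
      ⊆ {ω | c ^ 4 ≤ (∑ i ∈ Finset.range n, Y i ω) ^ 4} := fun ω hω => by
    have : c ^ 4 ≤ |∑ i ∈ Finset.range n, Y i ω| ^ 4 := pow_le_pow_left₀ hc.le (le_of_lt hω) 4
    rwa [(by decide : Even 4).pow_abs] at this
  refine (measure_mono hsub).trans ?_
  rw [← ENNReal.ofReal_toReal (measure_ne_top P _)]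
  refine ENNReal.ofReal_le_ofReal ?_
  rw [le_div_iff₀ (by positivity), mul_comm]
  exact hmark.trans hm

end Moments

section Chaining

/-- Dyadic chaining: increments over the dyadic intervals of each level control the function on
the finest grid. -/
theorem abs_dyadic_le_sum {H : ℝ → ℝ} (h0 : H 0 = 0) {b : ℕ → ℝ} (hb : ∀ r, 0 ≤ b r) (m : ℕ)
    (hinc : ∀ r < m, ∀ j < 2 ^ (r + 1),
      |H ((j + 1 : ℕ) / 2 ^ (r + 1)) - H ((j : ℕ) / 2 ^ (r + 1))| ≤ b r) :
    ∀ j ≤ 2 ^ m - 1, |H ((j : ℕ) / 2 ^ m)| ≤ ∑ r ∈ Finset.range m, b r := by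
  induction m with
  | zero => intro j hj; simp at hj; subst hj; simp [h0]
  | succ m ih =>
    have ih' := ih fun r hr => hinc r (hr.trans m.lt_succ_self)
    intro j hj
    rw [Finset.sum_range_succ]
    have hpos : 0 < 2 ^ m := by positivity
    obtain ⟨i, rfl | rfl⟩ := j.even_or_odd'
    · have h1 : ((2 * i : ℕ) : ℝ) / 2 ^ (m + 1) = (i : ℕ) / 2 ^ m := by
        push_cast; rw [pow_succ]; field_simp
      rw [h1]
      have := ih' i (by rw [pow_succ] at hj; omega)
      linarith [hb m]
    · have h1 : ((2 * i : ℕ) : ℝ) / 2 ^ (m + 1) = (i : ℕ) / 2 ^ m := by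
        push_cast; rw [pow_succ]; field_simp
      have h2 := ih' i (by rw [pow_succ] at hj; omega)
      have h3 := hinc m m.lt_succ_self (2 * i) (by rw [pow_succ] at hj ⊢; omega)
      rw [h1] at h3
      have h4 := abs_add_le (H ((2 * i + 1 : ℕ) / 2 ^ (m + 1)) - H ((i : ℕ) / 2 ^ m))
        (H ((i : ℕ) / 2 ^ m))
      rw [sub_add_cancel] at h4
      linarith

theorem empCDF_nonneg {n : ℕ} (x : Fin n → ℝ) (y : ℝ) : 0 ≤ empCDF x y := by
  unfold empCDF; positivity

theorem empCDF_le_one {n : ℕ} (x : Fin n → ℝ) (y : ℝ) : empCDF x y ≤ 1 := by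
  unfold empCDF
  refine div_le_one_of_le₀ ?_ (by positivity)
  exact_mod_cast (Finset.card_le_univ _).trans (by simp)

theorem empCDF_le_of_imp {n : ℕ} {x x' : Fin n → ℝ} {y y' : ℝ} (h : ∀ i, x i ≤ y → x' i ≤ y') :
    empCDF x y ≤ empCDF x' y' := by
  unfold empCDF
  refine div_le_div_of_nonneg_right ?_ (by positivity)
  exact_mod_cast Finset.card_le_card fun i hi => by
    simp only [Finset.mem_filter, Finset.mem_univ, true_and] at hi ⊢
    exact h i hi

/-- Passing from the real line to the unit interval: the deviation of the empirical distribution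
function from `F` is controlled by that of the transformed sample on a finite grid. -/
theorem abs_empCDF_sub_le_of_grid {F : ℝ → ℝ} (hF : Monotone F) (h0 : ∀ y, 0 ≤ F y)
    (h1 : ∀ y, F y ≤ 1) {n : ℕ} (x : Fin n → ℝ) {N : ℕ} (hN : 0 < N) {B : ℝ} (hB : 0 ≤ B)
    (h : ∀ j ≤ N - 1, |empCDF (fun i => F (x i)) ((j : ℕ) / N) - (j : ℕ) / N| ≤ B) (y : ℝ) :
    |empCDF x y - F y| ≤ B + 1 / N := by
  have hN' : (0 : ℝ) < N := by exact_mod_cast hN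
  set j := ⌈F y * N⌉₊ with hj
  have hj1 : F y ≤ j / N := by rw [le_div_iff₀ hN']; exact Nat.le_ceil _
  have hj2 : (j : ℝ) / N < F y + 1 / N := by
    rw [← sub_lt_iff_lt_add, ← sub_div, div_lt_iff₀ hN']
    linarith [Nat.ceil_lt_add_one (mul_nonneg (h0 y) hN'.le)]
  have hjN : j ≤ N := by
    rw [hj, Nat.ceil_le]; nlinarith [h1 y]
  rw [abs_le]
  constructor
  · rcases Nat.eq_zero_or_pos j with hj0 | hj0
    · have : F y ≤ 0 := by simpa [hj0] using hj1
      have : 0 ≤ 1 / (N : ℝ) := by positivity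
      linarith [empCDF_nonneg x y]
    · have hcast : ((j - 1 : ℕ) : ℝ) = j - 1 := by
        rw [Nat.cast_sub hj0, Nat.cast_one]
      have hlt : ((j - 1 : ℕ) : ℝ) / N < F y := by
        rw [hcast, sub_div]; linarith
      have := empCDF_le_of_imp (x := fun i => F (x i)) (x' := x) (y := ((j - 1 : ℕ) : ℝ) / N)
        (y' := y) fun i hi => (hF.reflect_lt (hi.trans_lt hlt)).le
      have h2 := (abs_le.1 (h (j - 1) (by omega))).1
      have : F y - 1 / N ≤ ((j - 1 : ℕ) : ℝ) / N := by rw [hcast, sub_div]; linarith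
      linarith
  · have h3 := empCDF_le_of_imp (x := x) (x' := fun i => F (x i)) (y := y) (y' := (j : ℝ) / N)
      fun i hi => (hF hi).trans hj1
    rcases hjN.eq_or_lt with hjN | hjN
    · have : (j : ℝ) / N = 1 := by rw [hjN]; exact div_self hN'.ne'
      linarith [empCDF_le_one x y]
    · have := (abs_le.1 (h j (by omega))).2
      linarith

variable {Ω : Type*} [MeasurableSpace Ω] {P : Measure Ω} [IsProbabilityMeasure P]

theorem card_filter_fin_eq_sum {n : ℕ} (u : ℕ → ℝ) (y : ℝ) :
    ((Finset.univ.filter fun i : Fin n => u i ≤ y).card : ℝ)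
      = ∑ i ∈ Finset.range n, (Iic y).indicator (fun _ => (1 : ℝ)) (u i) := by
  rw [← Fin.sum_univ_eq_sum_range (fun i => (Iic y).indicator (fun _ => (1 : ℝ)) (u i)) n,
    Finset.card_filter]
  push_cast
  exact Finset.sum_congr rfl fun i _ => by simp [indicator_apply]

theorem mul_empCDF_increment {n : ℕ} (hn : 0 < n) (u : ℕ → ℝ) {a b : ℝ} (hab : a ≤ b) :
    n * ((empCDF (fun i : Fin n => u i) b - b) - (empCDF (fun i : Fin n => u i) a - a))
      = ∑ i ∈ Finset.range n, ((Ioc a b).indicator (fun _ => (1 : ℝ)) (u i) - (b - a)) := by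
  have hn' : (n : ℝ) ≠ 0 := by exact_mod_cast hn.ne'
  unfold empCDF
  rw [card_filter_fin_eq_sum, card_filter_fin_eq_sum, Finset.sum_sub_distrib]
  have : ∑ i ∈ Finset.range n, (Ioc a b).indicator (fun _ => (1 : ℝ)) (u i)
      = ∑ i ∈ Finset.range n, (Iic b).indicator (fun _ => (1 : ℝ)) (u i)
        - ∑ i ∈ Finset.range n, (Iic a).indicator (fun _ => (1 : ℝ)) (u i) := by
    rw [← Finset.sum_sub_distrib]
    refine Finset.sum_congr rfl fun i _ => ?_
    simp only [indicator_apply, mem_Ioc, mem_Iic]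
    split_ifs <;> grind
  rw [this]
  simp
  field_simp
  ring

/-- Tail bound for one increment of the uniform empirical process. -/
theorem measure_increment_gt_le {U : ℕ → Ω → ℝ} (hU : ∀ i, Measurable (U i))
    (hind : iIndepFun U P)
    (hunif : ∀ i, ∀ u ∈ Icc (0 : ℝ) 1, P {ω | U i ω ≤ u} = ENNReal.ofReal u)
    {n : ℕ} (hn : 0 < n) {a b : ℝ} (ha : 0 ≤ a) (hab : a ≤ b) (hb : b ≤ 1) {c : ℝ} (hc : 0 < c) :
    P {ω | c < |(empCDF (fun i : Fin n => U i ω) b - b) - (empCDF (fun i : Fin n => U i ω) a - a)|}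
      ≤ ENNReal.ofReal ((n * (b - a) + 3 * n ^ 2 * (b - a) ^ 2) / (n * c) ^ 4) := by
  have hn' : (0 : ℝ) < n := by exact_mod_cast hn
  set g : ℝ → ℝ := fun y => (Ioc a b).indicator (fun _ => (1 : ℝ)) y - (b - a) with hg
  have hgm : Measurable g := (measurable_const.indicator measurableSet_Ioc).sub_const _
  have hprob : ∀ i, P.real (U i ⁻¹' Ioc a b) = b - a := fun i => by
    have : U i ⁻¹' Ioc a b = {ω | U i ω ≤ b} \ {ω | U i ω ≤ a} := by
      ext ω; simp [and_comm]
    rw [this, measureReal_sdiff (s₁ := {ω | U i ω ≤ b}) (s₂ := {ω | U i ω ≤ a})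
      (fun ω (h : U i ω ≤ a) => h.trans hab) (measurableSet_le (hU i) measurable_const),
      measureReal_def, measureReal_def,
      hunif i b ⟨ha.trans hab, hb⟩, hunif i a ⟨ha, hab.trans hb⟩,
      ENNReal.toReal_ofReal ha, ENNReal.toReal_ofReal (ha.trans hab)]
  have hI : ∀ i, ∫ ω, (Ioc a b).indicator (fun _ => (1 : ℝ)) (U i ω) ∂P = b - a := fun i => by
    have : (fun ω => (Ioc a b).indicator (fun _ => (1 : ℝ)) (U i ω))
        = (U i ⁻¹' Ioc a b).indicator (fun _ => (1 : ℝ)) := by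
      ext ω
      by_cases h : U i ω ∈ Ioc a b
      · rw [indicator_of_mem h, indicator_of_mem (show ω ∈ U i ⁻¹' Ioc a b from h)]
      · rw [indicator_of_notMem h, indicator_of_notMem (show ω ∉ U i ⁻¹' Ioc a b from h)]
    rw [this, integral_indicator_const _ (hU i measurableSet_Ioc), hprob i]; simp
  have hint : ∀ i, Integrable (fun ω => (Ioc a b).indicator (fun _ => (1 : ℝ)) (U i ω)) P := fun i =>
    integrable_of_abs_le ((measurable_const.indicator measurableSet_Ioc).comp (hU i)) 1 fun ω => by
      simp only [indicator_apply]; split_ifs <;> simp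
  have key := measure_abs_sum_gt_le (P := P) (Y := fun i ω => g (U i ω)) (fun i => hgm.comp (hU i))
    (hind.comp (fun _ => g) fun _ => hgm) (fun i ω => by
      simp only [hg, indicator_apply]
      split_ifs <;> rw [abs_le] <;> constructor <;> linarith) (fun i => by
      simp only [hg]
      rw [integral_sub (hint i) (integrable_const _), hI i]; simp) (p := b - a) (by linarith)
    (fun i => by
      have : ∀ ω, g (U i ω) ^ 2 = (1 - 2 * (b - a)) * (Ioc a b).indicator (fun _ => (1 : ℝ)) (U i ω)
          + (b - a) ^ 2 := fun ω => by
        simp only [hg, indicator_apply]; split_ifs <;> ring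
      simp_rw [this]
      rw [integral_add ((hint i).const_mul _) (integrable_const _), integral_const_mul, hI i]
      simp
      nlinarith [sq_nonneg (b - a)]) n (c := n * c) (by positivity)
  refine (measure_mono fun ω hω => ?_).trans key
  have := mul_empCDF_increment hn (fun i => U i ω) hab
  simp only [mem_ofPred_eq] at hω ⊢
  simp only [hg]
  rw [← this, abs_mul, abs_of_pos hn']
  exact mul_lt_mul_of_pos_left hω hn'

/-- The uniform empirical process is small on a dyadic grid of mesh at least `1 / n`, with
high probability uniformly in `n`. -/
theorem measure_grid_gt_le {U : ℕ → Ω → ℝ} (hU : ∀ i, Measurable (U i))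
    (hind : iIndepFun U P)
    (hunif : ∀ i, ∀ u ∈ Icc (0 : ℝ) 1, P {ω | U i ω ≤ u} = ENNReal.ofReal u)
    {n m : ℕ} (hm : 2 ^ m ≤ n) {c : ℝ} (hc : 0 < c) :
    P {ω | ¬ ∀ j ≤ 2 ^ m - 1,
        |empCDF (fun i : Fin n => U i ω) ((j : ℕ) / 2 ^ m) - (j : ℕ) / 2 ^ m| ≤ 10 * c / √n}
      ≤ ENNReal.ofReal (10 / c ^ 4) := by
  have hn : 0 < n := lt_of_lt_of_le (by positivity) hm
  have hn' : (0 : ℝ) < n := by exact_mod_cast hn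
  have hsq : 0 < √(n : ℝ) := Real.sqrt_pos.2 hn'
  -- The allowance at level `r` decays geometrically, but slowly enough, `2 * (9 / 10) ^ 4 > 1`, for
  -- the fourth moments over the `2 ^ (r + 1)` intervals to remain summable.
  set lam : ℕ → ℝ := fun r => c * (9 / 10) ^ r / √n with hlam
  have hlam0 : ∀ r, 0 < lam r := fun r => by positivity
  have hsum : ∀ m, ∑ r ∈ Finset.range m, lam r ≤ 10 * c / √n := fun m => by
    simp only [hlam]
    rw [← Finset.sum_div, ← Finset.mul_sum]
    have h9 : (0 : ℝ) ≤ (9 / 10) ^ m := by positivity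
    have : ∑ r ∈ Finset.range m, (9 / 10 : ℝ) ^ r ≤ 10 := by
      rw [geom_sum_eq (by norm_num), div_le_iff_of_neg (by norm_num)]
      linarith
    rw [mul_comm 10 c]
    gcongr
  set inc : ℕ → ℕ → Set Ω := fun r j => {ω | lam r <
    |(empCDF (fun i : Fin n => U i ω) ((j + 1 : ℕ) / 2 ^ (r + 1)) - (j + 1 : ℕ) / 2 ^ (r + 1))
      - (empCDF (fun i : Fin n => U i ω) ((j : ℕ) / 2 ^ (r + 1)) - (j : ℕ) / 2 ^ (r + 1))|}
    with hinc
  have hsub : {ω | ¬ ∀ j ≤ 2 ^ m - 1,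
        |empCDF (fun i : Fin n => U i ω) ((j : ℕ) / 2 ^ m) - (j : ℕ) / 2 ^ m| ≤ 10 * c / √n}
      ⊆ (⋃ i, {ω | U i ω ≤ 0}) ∪
        ⋃ r ∈ Finset.range m, ⋃ j ∈ Finset.range (2 ^ (r + 1)), inc r j := by
    intro ω hω
    by_contra hcon
    apply hω
    simp only [mem_union, mem_iUnion, mem_ofPred_eq, Finset.mem_range, not_or, not_exists,
      not_le, hinc, not_lt] at hcon
    intro j hj
    refine (abs_dyadic_le_sum (H := fun u => empCDF (fun i : Fin n => U i ω) u - u) ?_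
      (fun r => (hlam0 r).le) m (fun r hr j hj => hcon.2 r hr j hj) j hj).trans (hsum m)
    have : (Finset.univ.filter fun i : Fin n => U i ω ≤ 0) = ∅ := by
      ext i; simpa using hcon.1 i
    simp [empCDF, this]
  have hinc_le : ∀ r < m, ∀ j < 2 ^ (r + 1), P (inc r j)
      ≤ ENNReal.ofReal ((2 * (4 / 5) ^ r / c ^ 4) / 2 ^ (r + 1)) := by
    intro r hr j hj
    have h2 : (0 : ℝ) < 2 ^ (r + 1) := by positivity
    have hj' : ((j + 1 : ℕ) : ℝ) ≤ 2 ^ (r + 1) := by exact_mod_cast hj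
    have hd : ((j + 1 : ℕ) : ℝ) / 2 ^ (r + 1) - (j : ℕ) / 2 ^ (r + 1) = 1 / 2 ^ (r + 1) := by
      rw [← sub_div]; push_cast; ring
    refine (measure_increment_gt_le hU hind hunif hn (a := (j : ℕ) / 2 ^ (r + 1))
      (b := (j + 1 : ℕ) / 2 ^ (r + 1)) (by positivity) (by gcongr; simp)
      ((div_le_one h2).2 hj') (hlam0 r)).trans ?_
    rw [hd]
    refine ENNReal.ofReal_le_ofReal ?_
    have hnl : (n * lam r) ^ 4 = n ^ 2 * c ^ 4 * (6561 / 10000) ^ r := by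
      have h4 : (n * lam r) ^ 4 = n ^ 4 / (√n ^ 2) ^ 2 * c ^ 4 * ((9 / 10) ^ r) ^ 4 := by
        simp only [hlam, mul_pow, div_pow]; ring
      rw [h4, Real.sq_sqrt hn'.le, ← pow_mul, mul_comm r 4, pow_mul]
      have e4 : ((9 / 10 : ℝ) ^ 4) ^ r = (6561 / 10000) ^ r := by norm_num
      rw [e4]
      field_simp
    rw [hnl]
    have hnr : (2 : ℝ) ^ (r + 1) ≤ n := by
      have : 2 ^ (r + 1) ≤ n := (Nat.pow_le_pow_right (by norm_num) hr).trans hm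
      exact_mod_cast this
    have hpw : (1 : ℝ) ≤ (4 / 5) ^ r * (6561 / 10000) ^ r * 2 ^ r := by
      rw [← mul_pow, ← mul_pow]; exact one_le_pow₀ (by norm_num)
    rw [div_div, div_le_div_iff₀ (by positivity) (by positivity)]
    have e1 : (n * (1 / 2 ^ (r + 1)) + 3 * (n : ℝ) ^ 2 * (1 / 2 ^ (r + 1)) ^ 2)
          * (c ^ 4 * 2 ^ (r + 1)) = c ^ 4 * (n + 3 * n ^ 2 / 2 ^ (r + 1)) := by
      field_simp
    rw [e1]
    have e2 : (n : ℝ) + 3 * n ^ 2 / 2 ^ (r + 1) ≤ 4 * n ^ 2 / 2 ^ (r + 1) := by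
      rw [add_div' _ _ _ h2.ne', div_le_div_iff_of_pos_right h2]
      nlinarith
    have e3 : 4 * (n : ℝ) ^ 2 / 2 ^ (r + 1) ≤ 2 * (4 / 5) ^ r * (n ^ 2 * (6561 / 10000) ^ r) := by
      rw [div_le_iff₀ h2, pow_succ 2 r]
      have h5 := mul_le_mul_of_nonneg_left hpw (by positivity : 0 ≤ 4 * (n : ℝ) ^ 2)
      linarith
    calc c ^ 4 * (n + 3 * (n : ℝ) ^ 2 / 2 ^ (r + 1))
        ≤ c ^ 4 * (2 * (4 / 5) ^ r * (n ^ 2 * (6561 / 10000) ^ r)) := by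
          gcongr; exact e2.trans e3
      _ = _ := by ring
  have hlevel : ∀ r < m, P (⋃ j ∈ Finset.range (2 ^ (r + 1)), inc r j)
      ≤ ENNReal.ofReal (2 * (4 / 5) ^ r / c ^ 4) := by
    intro r hr
    refine (measure_biUnion_finset_le _ _).trans ?_
    refine (Finset.sum_le_sum fun j hj => hinc_le r hr j (Finset.mem_range.1 hj)).trans ?_
    rw [← ENNReal.ofReal_sum_of_nonneg fun _ _ => by positivity]
    refine ENNReal.ofReal_le_ofReal (le_of_eq ?_)
    rw [Finset.sum_const, Finset.card_range, nsmul_eq_mul]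
    push_cast
    field_simp
  refine (measure_mono hsub).trans ((measure_union_le _ _).trans ?_)
  have hz : P (⋃ i, {ω | U i ω ≤ 0}) = 0 :=
    measure_iUnion_null fun i => by simpa using hunif i 0 (by simp)
  rw [hz, zero_add]
  refine (measure_biUnion_finset_le _ _).trans ?_
  refine (Finset.sum_le_sum fun r hr => hlevel r (Finset.mem_range.1 hr)).trans ?_
  rw [← ENNReal.ofReal_sum_of_nonneg fun _ _ => by positivity]
  refine ENNReal.ofReal_le_ofReal ?_
  rw [← Finset.sum_div, ← Finset.mul_sum]
  have h4 : (0 : ℝ) ≤ (4 / 5) ^ m := by positivity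
  have : ∑ r ∈ Finset.range m, (4 / 5 : ℝ) ^ r ≤ 5 := by
    rw [geom_sum_eq (by norm_num), div_le_iff_of_neg (by norm_num)]
    linarith
  gcongr
  linarith

end Chaining

/-! ### Distribution functions of densities -/

section DistributionFunction

theorem IsDensity.integrable {f : ℝ → ℝ} (hf : IsDensity f) : Integrable f := by
  refine ⟨hf.measurable.aestronglyMeasurable, ?_⟩
  rw [hasFiniteIntegral_iff_ofReal (ae_of_all _ hf.nonneg), hf.lintegral_eq_one]
  exact ENNReal.one_lt_top

theorem IsDensity.isProbabilityMeasure {f : ℝ → ℝ} (hf : IsDensity f) :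
    IsProbabilityMeasure (volume.withDensity fun x => ENNReal.ofReal (f x)) :=
  ⟨by rw [withDensity_apply _ MeasurableSet.univ, setLIntegral_univ, hf.lintegral_eq_one]⟩

theorem IsDensity.ofReal_distFun {f : ℝ → ℝ} (hf : IsDensity f) (y : ℝ) :
    ENNReal.ofReal (distFun f y)
      = (volume.withDensity fun x => ENNReal.ofReal (f x)) (Iic y) := by
  rw [withDensity_apply _ measurableSet_Iic, distFun,
    ofReal_integral_eq_lintegral_ofReal hf.integrable.integrableOn (ae_of_all _ hf.nonneg)]

theorem IsDensity.distFun_sub {f : ℝ → ℝ} (hf : IsDensity f) (u v : ℝ) :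
    distFun f v - distFun f u = ∫ y in u..v, f y :=
  intervalIntegral.integral_Iic_sub_Iic hf.integrable.integrableOn hf.integrable.integrableOn

theorem IsDensity.distFun_eq_cdf {f : ℝ → ℝ} (hf : IsDensity f) :
    distFun f = cdf (volume.withDensity fun x => ENNReal.ofReal (f x)) := by
  have := hf.isProbabilityMeasure
  ext y
  rw [cdf_eq_real, measureReal_def, ← hf.ofReal_distFun, ENNReal.toReal_ofReal]
  exact integral_nonneg hf.nonneg

theorem IsDensity.monotone_distFun {f : ℝ → ℝ} (hf : IsDensity f) : Monotone (distFun f) := by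
  rw [hf.distFun_eq_cdf]; exact monotone_cdf _

theorem IsDensity.distFun_nonneg {f : ℝ → ℝ} (hf : IsDensity f) (y : ℝ) : 0 ≤ distFun f y := by
  rw [hf.distFun_eq_cdf]; exact cdf_nonneg _ _

theorem IsDensity.distFun_le_one {f : ℝ → ℝ} (hf : IsDensity f) (y : ℝ) : distFun f y ≤ 1 := by
  rw [hf.distFun_eq_cdf]; exact cdf_le_one _ _

theorem IsDensity.continuous_distFun {f : ℝ → ℝ} (hf : IsDensity f) : Continuous (distFun f) := by
  have : distFun f = fun y => (∫ x in (0 : ℝ)..y, f x) + distFun f 0 := by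
    ext y; rw [← hf.distFun_sub]; ring
  rw [this]
  exact (intervalIntegral.continuous_primitive (fun _ _ => hf.integrable.intervalIntegrable)
    0).add_const _

theorem IsDensity.tendsto_distFun_atTop {f : ℝ → ℝ} (hf : IsDensity f) :
    Tendsto (distFun f) atTop (𝓝 1) := by
  rw [hf.distFun_eq_cdf]; exact tendsto_cdf_atTop _

theorem IsDensity.tendsto_distFun_atBot {f : ℝ → ℝ} (hf : IsDensity f) :
    Tendsto (distFun f) atBot (𝓝 0) := by
  rw [hf.distFun_eq_cdf]; exact tendsto_cdf_atBot _

/-- The probability integral transform. -/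
theorem IsDensity.measure_distFun_le {f : ℝ → ℝ} (hf : IsDensity f) {u : ℝ}
    (hu : u ∈ Icc (0 : ℝ) 1) :
    (volume.withDensity fun x => ENNReal.ofReal (f x)) {y | distFun f y ≤ u}
      = ENNReal.ofReal u := by
  have hprob := hf.isProbabilityMeasure
  have hpos : ∀ u, 0 < u → u < 1 →
      (volume.withDensity fun x => ENNReal.ofReal (f x)) {y | distFun f y ≤ u}
        = ENNReal.ofReal u := by
    intro u h0 h1
    have hne : {y | distFun f y ≤ u}.Nonempty :=
      (hf.tendsto_distFun_atBot.eventually (eventually_le_nhds h0)).exists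
    obtain ⟨M, hM⟩ := (hf.tendsto_distFun_atTop.eventually (eventually_gt_nhds h1)).exists
    have hbdd : BddAbove {y | distFun f y ≤ u} :=
      ⟨M, fun y hy => (hf.monotone_distFun.reflect_lt (lt_of_le_of_lt hy hM)).le⟩
    have hcl : IsClosed {y | distFun f y ≤ u} := isClosed_le hf.continuous_distFun continuous_const
    set q := sSup {y | distFun f y ≤ u} with hq
    have hqmem : distFun f q ≤ u := hcl.csSup_mem hne hbdd
    have hset : {y | distFun f y ≤ u} = Iic q :=
      Subset.antisymm (fun y hy => le_csSup hbdd hy)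
        fun y hy => (hf.monotone_distFun hy).trans hqmem
    have hqu : distFun f q = u := by
      refine le_antisymm hqmem (le_of_not_gt fun hlt => ?_)
      have hev := (hf.continuous_distFun.tendsto q).eventually (eventually_lt_nhds hlt)
      obtain ⟨y, hy, hy'⟩ := ((hev.filter_mono nhdsWithin_le_nhds).and
        (self_mem_nhdsWithin : Ioi q ∈ 𝓝[>] q)).exists
      exact absurd (le_csSup hbdd (show y ∈ {y | distFun f y ≤ u} from hy.le)) (not_le.2 hy')
    rw [hset, ← hf.ofReal_distFun, hqu]
  rcases hu.1.eq_or_lt with rfl | h0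
  · refine le_antisymm (le_of_forall_gt fun c hc => ?_) (by simp)
    rw [ENNReal.ofReal_zero] at hc
    obtain ⟨v, hv0, hv⟩ : ∃ v : ℝ, (0 < v ∧ v < 1) ∧ ENNReal.ofReal v < c := by
      have hev : ∀ᶠ v : ℝ in 𝓝[>] 0, ENNReal.ofReal v < c := by
        have : Tendsto ENNReal.ofReal (𝓝 (0 : ℝ)) (𝓝 (ENNReal.ofReal 0)) :=
          ENNReal.continuous_ofReal.tendsto 0
        rw [ENNReal.ofReal_zero] at this
        exact (this.eventually (eventually_lt_nhds hc)).filter_mono nhdsWithin_le_nhds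
      have h1 : Ioo (0 : ℝ) 1 ∈ 𝓝[>] (0 : ℝ) := Ioo_mem_nhdsGT one_pos
      obtain ⟨v, hv, hv'⟩ := (hev.and h1).exists
      exact ⟨v, hv', hv⟩
    refine lt_of_le_of_lt ?_ hv
    rw [← hpos v hv0.1 hv0.2]
    exact measure_mono fun y (hy : distFun f y ≤ 0) => hy.trans hv0.1.le
  rcases hu.2.eq_or_lt with rfl | h1
  · have huniv : {y | distFun f y ≤ 1} = univ := eq_univ_of_forall fun y => hf.distFun_le_one y
    rw [ENNReal.ofReal_one, huniv, measure_univ]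
  · exact hpos u h0 h1

/-- Tightness of the Kolmogorov–Smirnov statistic `√n ‖F_n - F‖`, uniformly in the sample
size. -/
theorem measure_empCDF_deviation_le {Ω : Type*} [MeasurableSpace Ω] {P : Measure Ω}
    [IsProbabilityMeasure P] {f : ℝ → ℝ} (hf : IsDensity f) {X : ℕ → Ω → ℝ}
    (hX : ∀ i, Measurable (X i)) (hindep : iIndepFun X P)
    (hlaw : ∀ i, P.map (X i) = volume.withDensity fun x => ENNReal.ofReal (f x))
    {n : ℕ} (hn : 0 < n) {c : ℝ} (hc : 0 < c) :
    P {ω | ¬ ∀ y, |empCDF (fun i : Fin n => X i ω) y - distFun f y| ≤ (10 * c + 2) / √n}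
      ≤ ENNReal.ofReal (10 / c ^ 4) := by
  have hFm : Measurable (distFun f) := hf.continuous_distFun.measurable
  have hn' : (0 : ℝ) < n := by exact_mod_cast hn
  have hm := Nat.pow_log_le_self 2 hn.ne'
  refine (measure_mono fun ω hω => ?_).trans
    (measure_grid_gt_le (U := fun i ω => distFun f (X i ω)) (fun i => hFm.comp (hX i))
      (hindep.comp (fun _ => distFun f) fun _ => hFm) (fun i u hu => ?_) hm hc)
  · intro hgrid
    refine hω fun y => ?_
    have := abs_empCDF_sub_le_of_grid hf.monotone_distFun hf.distFun_nonneg hf.distFun_le_one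
      (fun i : Fin n => X i ω) (N := 2 ^ Nat.log 2 n) (by positivity) (B := 10 * c / √n)
      (by positivity) (by push_cast; exact hgrid) y
    refine this.trans ?_
    rw [add_div]
    refine add_le_add le_rfl ?_
    have h2 : (n : ℝ) ≤ 2 ^ Nat.log 2 n * 2 := by
      have := (Nat.lt_pow_succ_log_self (b := 2) (by norm_num) n).le
      rw [pow_succ] at this
      exact_mod_cast this
    have h3 : √(n : ℝ) ≤ n := by
      rw [Real.sqrt_le_left hn'.le]
      have : (1 : ℝ) ≤ n := by exact_mod_cast hn
      nlinarith
    push_cast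
    rw [div_le_div_iff₀ (by positivity) (Real.sqrt_pos.2 hn')]
    linarith
  · rw [← hf.measure_distFun_le hu, ← hlaw i,
      Measure.map_apply (hX i) (measurableSet_le hFm measurable_const)]
    rfl

end DistributionFunction

/-! ### Lengths of graphs -/

/-- The point of the graph of `S` above `y`, in the Euclidean plane. -/
abbrev graphPoint (S : ℝ → ℝ) (y : ℝ) : WithLp 2 (ℝ × ℝ) := WithLp.toLp 2 (y, S y)

/-- The chord of `S` over `[u, v]`, as an affine function on the line. -/
def chord (S : ℝ → ℝ) (u v y : ℝ) : ℝ := S u + (S v - S u) / (v - u) * (y - u)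

@[simp] theorem chord_left (S : ℝ → ℝ) (u v : ℝ) : chord S u v u = S u := by simp [chord]

theorem chord_right (S : ℝ → ℝ) {u v : ℝ} (h : u < v) : chord S u v v = S v := by
  have : v - u ≠ 0 := (sub_pos.2 h).ne'
  simp [chord, this]

theorem continuous_chord (S : ℝ → ℝ) (u v : ℝ) : Continuous (chord S u v) := by
  unfold chord; fun_prop

theorem monotone_chord {S : ℝ → ℝ} {u v : ℝ} (h : u ≤ v) (hS : S u ≤ S v) :
    Monotone (chord S u v) := fun y y' hy => by
  unfold chord
  have : 0 ≤ (S v - S u) / (v - u) := div_nonneg (sub_nonneg.2 hS) (sub_nonneg.2 h)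
  gcongr

theorem dist_graphPoint (S T : ℝ → ℝ) (y y' : ℝ) :
    dist (graphPoint S y) (graphPoint T y') = √((y - y') ^ 2 + (S y - T y') ^ 2) := by
  rw [WithLp.prod_dist_eq_of_L2]
  simp [Real.dist_eq, sq_abs]

theorem graphLength_congr {u v : ℝ} {S T : ℝ → ℝ} (h : EqOn S T (Icc u v)) :
    graphLength u v S = graphLength u v T :=
  eVariationOn.congr fun y hy => by simp [h hy]

theorem graphLength_add {u v w : ℝ} (huv : u ≤ v) (hvw : v ≤ w) (S : ℝ → ℝ) :
    graphLength u v S + graphLength v w S = graphLength u w S := by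
  have := eVariationOn.Icc_add_Icc (graphPoint S) (s := univ) huv hvw (mem_univ v)
  simp only [univ_inter] at this
  exact this

theorem edist_le_graphLength {u v : ℝ} (h : u ≤ v) (S : ℝ → ℝ) :
    edist (graphPoint S u) (graphPoint S v) ≤ graphLength u v S :=
  eVariationOn.edist_le (graphPoint S) (left_mem_Icc.2 h) (right_mem_Icc.2 h)

theorem graphLength_ne_top {u v : ℝ} {S : ℝ → ℝ} (huv : u ≤ v) (hS : MonotoneOn S (Icc u v)) :
    graphLength u v S ≠ ⊤ := by
  have hmono : MonotoneOn (fun y => y + S y) (Icc u v) := fun y hy y' hy' h =>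
    add_le_add h (hS hy hy' h)
  have h1 : graphLength u v S ≤ eVariationOn (fun y => y + S y) (Icc u v) := by
    refine iSup_le fun ⟨n, w, hw, hwm⟩ => ?_
    refine le_trans (Finset.sum_le_sum fun i _ => ?_) (eVariationOn.sum_le hw hwm (n := n))
    rw [edist_dist, edist_dist]
    refine ENNReal.ofReal_le_ofReal ?_
    have a1 : 0 ≤ w (i + 1) - w i := sub_nonneg.2 (hw i.le_succ)
    have a2 : 0 ≤ S (w (i + 1)) - S (w i) := sub_nonneg.2 (hS (hwm _) (hwm _) (hw i.le_succ))
    refine (dist_graphPoint S S _ _).trans_le ?_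
    rw [Real.dist_eq, abs_of_nonneg (by linarith), Real.sqrt_le_left (by linarith)]
    nlinarith [mul_nonneg a1 a2]
  have h2 := hmono.eVariationOn_eq (left_mem_Icc.2 huv) (right_mem_Icc.2 huv)
  rw [inter_self] at h2
  exact ne_top_of_le_ne_top ENNReal.ofReal_ne_top (h1.trans h2.le)

/-- A segment is no longer than the distance of its endpoints. -/
theorem graphLength_chord_le {u v : ℝ} (h : u < v) (S : ℝ → ℝ) :
    graphLength u v (chord S u v) ≤ edist (graphPoint S u) (graphPoint S v) := by
  set β := (S v - S u) / (v - u) with hβ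
  have hvu : 0 < v - u := sub_pos.2 h
  have hd : ∀ y y', dist (graphPoint (chord S u v) y) (graphPoint (chord S u v) y')
      = √(1 + β ^ 2) * |y - y'| := fun y y' => by
    rw [dist_graphPoint, ← Real.sqrt_sq_eq_abs, ← Real.sqrt_mul (by positivity)]
    congr 1
    simp only [chord, ← hβ]
    ring
  have hend : dist (graphPoint S u) (graphPoint S v) = √(1 + β ^ 2) * |u - v| := by
    rw [← hd u v, dist_graphPoint, dist_graphPoint, chord_left, chord_right S h]
  refine iSup_le fun ⟨n, w, hw, hwm⟩ => ?_
  have hterm : ∀ i, edist (graphPoint (chord S u v) (w (i + 1))) (graphPoint (chord S u v) (w i))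
      = ENNReal.ofReal (√(1 + β ^ 2) * (w (i + 1) - w i)) := fun i => by
    rw [edist_dist, hd, abs_of_nonneg (sub_nonneg.2 (hw i.le_succ))]
  refine (Finset.sum_congr rfl fun i _ => hterm i).trans_le ?_
  rw [← ENNReal.ofReal_sum_of_nonneg fun i _ =>
      mul_nonneg (Real.sqrt_nonneg _) (sub_nonneg.2 (hw i.le_succ)),
    ← Finset.mul_sum, Finset.sum_range_sub, edist_dist, hend]
  refine ENNReal.ofReal_le_ofReal (mul_le_mul_of_nonneg_left ?_ (Real.sqrt_nonneg _))
  rw [abs_sub_comm, abs_of_pos hvu]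
  linarith [(hwm n).2, (hwm 0).1]

/-- Strict convexity of the Euclidean plane: a graph that is no longer than its chord is the
chord. -/
theorem eq_chord_of_graphLength_le {u v : ℝ} (h : u < v) {S : ℝ → ℝ}
    (hS : graphLength u v S ≤ edist (graphPoint S u) (graphPoint S v)) :
    ∀ y ∈ Icc u v, S y = chord S u v y := by
  intro y hy
  have h1 : edist (graphPoint S u) (graphPoint S y) + edist (graphPoint S y) (graphPoint S v)
      ≤ edist (graphPoint S u) (graphPoint S v) := by
    refine le_trans ?_ hS
    rw [← graphLength_add hy.1 hy.2 S]
    exact add_le_add (edist_le_graphLength hy.1 S) (edist_le_graphLength hy.2 S)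
  have h2 : dist (graphPoint S u) (graphPoint S y) + dist (graphPoint S y) (graphPoint S v)
      = dist (graphPoint S u) (graphPoint S v) := by
    refine le_antisymm ?_ (dist_triangle _ _ _)
    rw [edist_dist, edist_dist, edist_dist, ← ENNReal.ofReal_add dist_nonneg dist_nonneg] at h1
    exact (ENNReal.ofReal_le_ofReal_iff dist_nonneg).1 h1
  obtain ⟨r, -, hr⟩ := dist_add_dist_eq_iff.1 h2
  have hfst := congrArg (fun p : WithLp 2 (ℝ × ℝ) => p.fst) hr
  have hsnd := congrArg (fun p : WithLp 2 (ℝ × ℝ) => p.snd) hr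
  simp [AffineMap.lineMap_apply] at hfst hsnd
  have hvu : v - u ≠ 0 := (sub_pos.2 h).ne'
  unfold chord
  rw [← hsnd, ← hfst]
  field_simp
  ring

/-! ### Replacing an arc of the taut string by its chord -/

/-- `S` with its arc over `[u, v]` replaced by the chord. The clamped argument makes continuity
evident. -/
def replaceChord (S : ℝ → ℝ) (u v y : ℝ) : ℝ :=
  S y - S (max u (min y v)) + chord S u v (max u (min y v))

theorem replaceChord_of_mem (S : ℝ → ℝ) {u v y : ℝ} (hy : y ∈ Icc u v) :
    replaceChord S u v y = chord S u v y := by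
  simp [replaceChord, min_eq_left hy.2, max_eq_right hy.1]

theorem replaceChord_of_le (S : ℝ → ℝ) {u v y : ℝ} (huv : u < v) (hy : y ≤ u) :
    replaceChord S u v y = S y := by
  simp [replaceChord, min_eq_left (hy.trans huv.le), max_eq_left hy]

theorem replaceChord_of_ge (S : ℝ → ℝ) {u v y : ℝ} (huv : u < v) (hy : v ≤ y) :
    replaceChord S u v y = S y := by
  simp [replaceChord, min_eq_right hy, max_eq_right huv.le, chord_right S huv]

section Strings

variable {n : ℕ} {x : Fin n → ℝ} {ε : ℝ}

theorem IsTubeString.replaceChord {S : ℝ → ℝ} (hS : IsTubeString x ε S) {u v : ℝ}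
    (hu : sampleMin x ≤ u) (huv : u < v) (hv : v ≤ sampleMax x)
    (htube : ∀ y ∈ Icc u v, |chord S u v y - empCDF x y| ≤ ε) :
    IsTubeString x ε (replaceChord S u v) := by
  have hclamp : ∀ y ∈ Icc (sampleMin x) (sampleMax x),
      max u (min y v) ∈ Icc (sampleMin x) (sampleMax x) := fun y _ =>
    ⟨hu.trans (le_max_left _ _), max_le (huv.le.trans hv) ((min_le_right _ _).trans hv)⟩
  have hmem : ∀ y, u ≤ y → y ≤ v → y ∈ Icc (sampleMin x) (sampleMax x) := fun y h1 h2 =>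
    ⟨hu.trans h1, h2.trans hv⟩
  have hSuv : S u ≤ S v :=
    hS.monotoneOn (hmem u le_rfl huv.le) (hmem v huv.le le_rfl) huv.le
  have hcm := monotone_chord huv.le hSuv
  refine ⟨?_, ?_, ?_, ?_, ?_⟩
  · refine ContinuousOn.add (hS.continuousOn.sub (hS.continuousOn.comp ?_ hclamp)) ?_
    · fun_prop
    · exact ((continuous_chord S u v).comp (by fun_prop)).continuousOn
  · intro y hy y' hy' hyy'
    have hstep1 : ∀ y ∈ Icc (sampleMin x) (sampleMax x), y ≤ v →
        TautString.replaceChord S u v y ≤ chord S u v (max u y) := fun y hy hyv => by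
      rcases le_total y u with h | h
      · rw [replaceChord_of_le S huv h, max_eq_left h, chord_left]
        exact hS.monotoneOn hy (hmem u le_rfl huv.le) h
      · rw [replaceChord_of_mem S ⟨h, hyv⟩, max_eq_right h]
    rcases le_total y' u with h' | h'
    · rw [replaceChord_of_le S huv h', replaceChord_of_le S huv (hyy'.trans h')]
      exact hS.monotoneOn hy hy' hyy'
    rcases le_total y' v with h2 | h2
    · rw [replaceChord_of_mem S ⟨h', h2⟩]
      exact (hstep1 y hy (hyy'.trans h2)).trans (hcm (max_le h' hyy'))
    · rw [replaceChord_of_ge S huv h2]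
      rcases le_total v y with h3 | h3
      · rw [replaceChord_of_ge S huv h3]; exact hS.monotoneOn hy hy' hyy'
      · refine (hstep1 y hy h3).trans ((hcm (max_le huv.le h3)).trans ?_)
        rw [chord_right S huv]
        exact hS.monotoneOn (hmem v huv.le le_rfl) hy' h2
  · intro y hy
    rcases le_total y u with h | h
    · rw [replaceChord_of_le S huv h]; exact hS.mem_tube y hy
    rcases le_total y v with h2 | h2
    · rw [replaceChord_of_mem S ⟨h, h2⟩]; exact htube y ⟨h, h2⟩
    · rw [replaceChord_of_ge S huv h2]; exact hS.mem_tube y hy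
  · rw [replaceChord_of_le S huv hu, hS.left_eq]
  · rw [replaceChord_of_ge S huv hv, hS.right_eq]

/-- The taut string is affine wherever its chord stays in the tube. -/
theorem IsTautString.eq_chord {S : ℝ → ℝ} (hS : IsTautString x ε S) {u v : ℝ}
    (hu : sampleMin x ≤ u) (huv : u < v) (hv : v ≤ sampleMax x)
    (htube : ∀ y ∈ Icc u v, |chord S u v y - empCDF x y| ≤ ε) :
    ∀ y ∈ Icc u v, S y = chord S u v y := by
  have hT := hS.2 _ (hS.1.replaceChord hu huv hv htube)
  refine eq_chord_of_graphLength_le huv ?_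
  have hfin := graphLength_ne_top (hu.trans (huv.le.trans hv)) hS.1.monotoneOn
  rw [← graphLength_add hu (huv.le.trans hv), ← graphLength_add huv.le hv,
    ← graphLength_add hu (huv.le.trans hv) (replaceChord S u v),
    ← graphLength_add huv.le hv (replaceChord S u v),
    graphLength_congr (T := S) fun y hy => replaceChord_of_le S huv hy.2,
    graphLength_congr (u := u) (T := chord S u v) fun y hy => replaceChord_of_mem S hy,
    graphLength_congr (u := v) (T := S) fun y hy => replaceChord_of_ge S huv hy.1] at hT
  rw [← graphLength_add hu (huv.le.trans hv), ← graphLength_add huv.le hv] at hfin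
  simp only [ne_eq, ENNReal.add_eq_top, not_or] at hfin
  exact ((ENNReal.add_le_add_iff_right hfin.2.2).1
    ((ENNReal.add_le_add_iff_left hfin.1).1 hT)).trans (graphLength_chord_le huv S)

/-! ### Knots and polygonal interpolation -/

/-- A finite set cuts `[a, b]` into finitely many intervals with no point of the set inside. -/
theorem exists_knots {a b : ℝ} (hab : a < b) (K : Finset ℝ) :
    ∃ (m : ℕ) (z : ℕ → ℝ), StrictMono z ∧ z 0 = a ∧ z m = b ∧
      ∀ i < m, ∀ y ∈ K, ¬ (z i < y ∧ y < z (i + 1)) := by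
  induction K using Finset.induction_on_max generalizing b with
  | empty =>
    refine ⟨1, fun i => a + i * (b - a), fun i j hij => ?_, by simp, by simp, by simp⟩
    have : (i : ℝ) < j := by exact_mod_cast hij
    have := sub_pos.2 hab
    simp only
    gcongr
  | insert p K hp ih =>
    by_cases hpab : a < p ∧ p < b
    · obtain ⟨m, z, hz, h0, hm, hK⟩ := ih hpab.1
      refine ⟨m + 1, fun i => if i ≤ m then z i else b + (i - (m + 1)), ?_, by simp [h0], by simp,
        fun i hi y hy => ?_⟩
      · refine strictMono_nat_of_lt_succ fun i => ?_
        rcases lt_trichotomy i m with h | rfl | h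
        · rw [if_pos h.le, if_pos (by omega : i + 1 ≤ m)]; exact hz (Nat.lt_succ_self i)
        · rw [if_pos le_rfl, if_neg (by omega), hm]; push_cast; linarith [hpab.2]
        · rw [if_neg (by omega), if_neg (by omega)]; push_cast; linarith
      · rcases Nat.lt_succ_iff_lt_or_eq.1 hi with h | rfl
        · simp only [if_pos h.le, if_pos (by omega : i + 1 ≤ m)]
          rcases Finset.mem_insert.1 hy with rfl | hy
          · have : z (i + 1) ≤ z m := hz.monotone (by omega)
            rintro ⟨-, h2⟩; linarith
          · exact hK i h y hy
        · simp only [le_refl, if_true, hm]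
          rintro ⟨h1, -⟩
          rcases Finset.mem_insert.1 hy with rfl | hy
          · exact lt_irrefl _ h1
          · exact lt_asymm h1 (hp y hy)
    · obtain ⟨m, z, hz, h0, hm, hK⟩ := ih hab
      refine ⟨m, z, hz, h0, hm, fun i hi y hy => ?_⟩
      rcases Finset.mem_insert.1 hy with rfl | hy
      · rintro ⟨h1, h2⟩
        refine hpab ⟨?_, ?_⟩
        · rw [← h0]; exact (hz.monotone i.zero_le).trans_lt h1
        · rw [← hm]; exact h2.trans_le (hz.monotone hi)
      · exact hK i hi y hy

/-- The polygon through the points `(z i, v i)`, `i ≤ m`, constant on both sides. -/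
def interp (z v : ℕ → ℝ) (m : ℕ) (y : ℝ) : ℝ :=
  v 0 + ∑ j ∈ Finset.range m,
    (v (j + 1) - v j) / (z (j + 1) - z j) * (max (z j) (min y (z (j + 1))) - z j)

theorem continuous_interp (z v : ℕ → ℝ) (m : ℕ) : Continuous (interp z v m) := by
  unfold interp; fun_prop

theorem continuous_interp_values (z : ℕ → ℝ) (m : ℕ) (y : ℝ) :
    Continuous fun v : ℕ → ℝ => interp z v m y := by
  unfold interp; fun_prop

theorem interp_of_ge {z : ℕ → ℝ} (hz : StrictMono z) (v : ℕ → ℝ) (m : ℕ) {y : ℝ} (hy : z m ≤ y) :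
    interp z v m y = v m := by
  have : ∀ j ∈ Finset.range m, (v (j + 1) - v j) / (z (j + 1) - z j)
      * (max (z j) (min y (z (j + 1))) - z j) = v (j + 1) - v j := fun j hj => by
    have h1 : z (j + 1) ≤ y := (hz.monotone (Finset.mem_range.1 hj)).trans hy
    have h2 : z j < z (j + 1) := hz j.lt_succ_self
    rw [min_eq_right h1, max_eq_right h2.le, div_mul_cancel₀ _ (sub_pos.2 h2).ne']
  rw [interp, Finset.sum_congr rfl this, Finset.sum_range_sub]
  ring

theorem interp_succ_of_le {z : ℕ → ℝ} (v : ℕ → ℝ) (m : ℕ) {y : ℝ}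
    (hy : y ≤ z m) : interp z v (m + 1) y = interp z v m y := by
  rw [interp, Finset.sum_range_succ, max_eq_left ((min_le_left _ _).trans hy)]
  simp [interp]

theorem interp_of_mem {z : ℕ → ℝ} (hz : StrictMono z) (v : ℕ → ℝ) {m i : ℕ} (hi : i < m) {y : ℝ}
    (hy : y ∈ Icc (z i) (z (i + 1))) :
    interp z v m y = v i + (v (i + 1) - v i) / (z (i + 1) - z i) * (y - z i) := by
  induction m with
  | zero => omega
  | succ m ih =>
    rcases Nat.lt_succ_iff_lt_or_eq.1 hi with h | rfl
    · rw [interp_succ_of_le v m (hy.2.trans (hz.monotone h)), ih h]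
    · have := interp_of_ge hz v i hy.1
      rw [interp] at this ⊢
      rw [Finset.sum_range_succ, ← add_assoc, this, min_eq_left hy.2, max_eq_right hy.1]

theorem interp_knot {z : ℕ → ℝ} (hz : StrictMono z) (v : ℕ → ℝ) {m i : ℕ} (hi : i ≤ m) :
    interp z v m (z i) = v i := by
  rcases hi.lt_or_eq with h | rfl
  · rw [interp_of_mem hz v h ⟨le_rfl, hz.monotone i.le_succ⟩]; simp
  · exact interp_of_ge hz v i le_rfl

theorem monotone_interp {z : ℕ → ℝ} (hz : StrictMono z) {v : ℕ → ℝ} {m : ℕ}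
    (hv : ∀ i < m, v i ≤ v (i + 1)) : Monotone (interp z v m) := fun y y' h => by
  unfold interp
  gcongr with j hj
  exact div_nonneg (sub_nonneg.2 (hv j (Finset.mem_range.1 hj)))
    (sub_nonneg.2 (hz.monotone j.le_succ))

/-- Every point of `[z 0, z m)` lies in one of the intervals `[z i, z (i + 1))`. -/
theorem exists_mem_Ico_knots {z : ℕ → ℝ} {m : ℕ} {y : ℝ} (h0 : z 0 ≤ y) (hm : y < z m) :
    ∃ i < m, y ∈ Ico (z i) (z (i + 1)) := by
  induction m with
  | zero => exact absurd h0 (not_le.2 hm)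
  | succ m ih =>
    rcases lt_or_ge y (z m) with h | h
    · obtain ⟨i, hi, hy⟩ := ih h
      exact ⟨i, hi.trans m.lt_succ_self, hy⟩
    · exact ⟨m, m.lt_succ_self, h, hm⟩

/-- Comparing lengths knot by knot. -/
theorem graphLength_le_of_knots {z : ℕ → ℝ} (hz : Monotone z) {S T : ℝ → ℝ} {m : ℕ}
    (h : ∀ i < m, graphLength (z i) (z (i + 1)) S ≤ graphLength (z i) (z (i + 1)) T) :
    graphLength (z 0) (z m) S ≤ graphLength (z 0) (z m) T := by
  unfold graphLength
  rw [← eVariationOn.sum' (graphPoint S) hz, ← eVariationOn.sum' (graphPoint T) hz]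
  exact Finset.sum_le_sum fun i hi => h i (Finset.mem_range.1 hi)

theorem empCDF_mono (x : Fin n → ℝ) : Monotone (empCDF x) := fun _ _ h =>
  empCDF_le_of_imp fun _ hi => le_trans hi h

theorem empCDF_eq_of_no_obs {u y : ℝ} (huy : u ≤ y) (h : ∀ l, x l ≤ y → x l ≤ u) :
    empCDF x y = empCDF x u :=
  le_antisymm (empCDF_le_of_imp h) (empCDF_mono x huy)

/-- The tube over an interval without observations inside is seen at the endpoints. -/
theorem IsTubeString.le_of_no_obs {T : ℝ → ℝ} (hT : IsTubeString x ε T) {u v : ℝ}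
    (hu : sampleMin x ≤ u) (huv : u < v) (hv : v ≤ sampleMax x)
    (hobs : ∀ l, ¬ (u < x l ∧ x l < v)) :
    empCDF x u - ε ≤ T u ∧ T v ≤ empCDF x u + ε := by
  constructor
  · linarith [(abs_le.1 (hT.mem_tube u ⟨hu, huv.le.trans hv⟩)).1]
  · have hcont : ContinuousWithinAt T (Ico u v) v :=
      (hT.continuousOn v ⟨hu.trans huv.le, hv⟩).mono fun y hy => ⟨hu.trans hy.1, hy.2.le.trans hv⟩
    have hne : (𝓝[Ico u v] v).NeBot := by
      rw [← mem_closure_iff_nhdsWithin_neBot, closure_Ico huv.ne]; exact right_mem_Icc.2 huv.le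
    refine le_of_tendsto hcont ?_
    filter_upwards [self_mem_nhdsWithin] with y hy
    have := (abs_le.1 (hT.mem_tube y ⟨hu.trans hy.1, hy.2.le.trans hv⟩)).2
    rw [empCDF_eq_of_no_obs hy.1 fun l hl => le_of_not_gt fun hul =>
      hobs l ⟨hul, hl.trans_lt hy.2⟩] at this
    linarith

/-- Interpolating a string of the tube at knots that include all observations leaves it in the
tube and does not lengthen it. -/
theorem IsTubeString.interp {T : ℝ → ℝ} (hT : IsTubeString x ε T) {z : ℕ → ℝ} (hz : StrictMono z)
    {m : ℕ} (h0 : z 0 = sampleMin x) (hm : z m = sampleMax x)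
    (hobs : ∀ i < m, ∀ l, ¬ (z i < x l ∧ x l < z (i + 1))) {v : ℕ → ℝ}
    (hv : ∀ i ≤ m, v i = T (z i)) :
    IsTubeString x ε (interp z v m) ∧
      graphLength (sampleMin x) (sampleMax x) (TautString.interp z v m)
        ≤ graphLength (sampleMin x) (sampleMax x) T := by
  have hmem : ∀ i ≤ m, z i ∈ Icc (sampleMin x) (sampleMax x) := fun i hi => by
    rw [← h0, ← hm]; exact ⟨hz.monotone i.zero_le, hz.monotone hi⟩
  have hmono := monotone_interp (v := v) (m := m) hz fun i hi => by
    rw [hv i hi.le, hv (i + 1) hi]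
    exact hT.monotoneOn (hmem i hi.le) (hmem _ hi) (hz.monotone i.le_succ)
  refine ⟨⟨(continuous_interp z v m).continuousOn, hmono.monotoneOn _, fun y hy => ?_, ?_, ?_⟩, ?_⟩
  · rcases hy.2.lt_or_eq with h | h
    · rw [← hm] at h
      obtain ⟨i, hi, hyi⟩ := exists_mem_Ico_knots (h0.trans_le hy.1) h
      obtain ⟨h1, h2⟩ := hT.le_of_no_obs (hmem i hi.le).1 (hz i.lt_succ_self) (hmem (i + 1) hi).2
        (hobs i hi)
      rw [← hv i hi.le, ← interp_knot hz v hi.le] at h1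
      rw [← hv (i + 1) hi, ← interp_knot hz v hi] at h2
      rw [empCDF_eq_of_no_obs hyi.1 fun l hl => le_of_not_gt fun hul =>
        hobs i hi l ⟨hul, hl.trans_lt hyi.2⟩, abs_le]
      constructor <;> linarith [hmono hyi.1, hmono hyi.2.le]
    · have h3 := hT.mem_tube y hy
      rw [← hm] at h
      rw [h, interp_knot hz v le_rfl, hv m le_rfl, ← h]
      exact h3
  · rw [← h0, interp_knot hz v m.zero_le, hv 0 m.zero_le, h0, hT.left_eq]
  · rw [← hm, interp_knot hz v le_rfl, hv m le_rfl, hm, hT.right_eq]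
  · rw [← h0, ← hm]
    refine graphLength_le_of_knots hz.monotone fun i hi => ?_
    have heq : EqOn (TautString.interp z v m) (chord T (z i) (z (i + 1)))
        (Icc (z i) (z (i + 1))) := fun y hy => by
      rw [interp_of_mem hz v hi hy, chord, hv i hi.le, hv (i + 1) hi]
    rw [graphLength_congr heq]
    exact (graphLength_chord_le (hz i.lt_succ_self) T).trans
      (edist_le_graphLength (hz.monotone i.le_succ) T)

/-- The taut string exists as soon as the tube contains a string: polygons through the
observations form a compact family, and length is lower semicontinuous. -/
theorem exists_isTautString (hab : sampleMin x < sampleMax x) {T₀ : ℝ → ℝ}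
    (hT₀ : IsTubeString x ε T₀) : ∃ S, IsTautString x ε S := by
  obtain ⟨m, z, hz, h0, hm, hobs⟩ := exists_knots hab (Finset.univ.image x)
  replace hobs : ∀ i < m, ∀ l, ¬ (z i < x l ∧ x l < z (i + 1)) := fun i hi l =>
    hobs i hi (x l) (Finset.mem_image_of_mem _ (Finset.mem_univ l))
  set K : Set (ℕ → ℝ) := {v | (∀ i, v i ∈ Icc (0 : ℝ) 1) ∧ IsTubeString x ε (interp z v m)} with hK
  have hvals : ∀ T, IsTubeString x ε T → (fun i => T (z (min i m))) ∈ K := fun T hT => by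
    refine ⟨fun i => ?_, (hT.interp hz h0 hm hobs fun i hi => by rw [min_eq_left hi]).1⟩
    have hmem : z (min i m) ∈ Icc (sampleMin x) (sampleMax x) := by
      rw [← h0, ← hm]; exact ⟨hz.monotone (Nat.zero_le _), hz.monotone (min_le_right _ _)⟩
    rw [← hT.left_eq, ← hT.right_eq]
    exact ⟨hT.monotoneOn (left_mem_Icc.2 hab.le) hmem hmem.1,
      hT.monotoneOn hmem (right_mem_Icc.2 hab.le) hmem.2⟩
  have hcompact : IsCompact K := by
    have hbox : IsCompact (univ.pi fun _ : ℕ => Icc (0 : ℝ) 1) :=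
      isCompact_univ_pi fun _ => isCompact_Icc
    refine hbox.of_isClosed_subset ?_ fun v hv i _ => hv.1 i
    have hci := continuous_interp_values z m
    have hKeq : K = {v | (∀ i, v i ∈ Icc (0 : ℝ) 1) ∧
        (∀ y ∈ Icc (sampleMin x) (sampleMax x), ∀ y' ∈ Icc (sampleMin x) (sampleMax x), y ≤ y' →
          interp z v m y ≤ interp z v m y') ∧
        (∀ y ∈ Icc (sampleMin x) (sampleMax x), |interp z v m y - empCDF x y| ≤ ε) ∧
        interp z v m (sampleMin x) = 0 ∧ interp z v m (sampleMax x) = 1} := by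
      ext v
      constructor
      · rintro ⟨h1, h2⟩
        exact ⟨h1, fun y hy y' hy' h => h2.monotoneOn hy hy' h, h2.mem_tube, h2.left_eq, h2.right_eq⟩
      · rintro ⟨h1, h2, h3, h4, h5⟩
        exact ⟨h1, (continuous_interp z v m).continuousOn, fun y hy y' hy' h => h2 y hy y' hy' h,
          h3, h4, h5⟩
    rw [hKeq]
    simp only [ofPred_and, ofPred_forall]
    refine IsClosed.inter (isClosed_iInter fun i => isClosed_Icc.preimage (continuous_apply i))
      (IsClosed.inter ?_ (IsClosed.inter ?_ (IsClosed.inter ?_ ?_)))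
    · exact isClosed_iInter fun y => isClosed_iInter fun _ => isClosed_iInter fun y' =>
        isClosed_iInter fun _ => isClosed_iInter fun _ => isClosed_le (hci y) (hci y')
    · exact isClosed_iInter fun y => isClosed_iInter fun _ =>
        isClosed_le ((hci y).sub continuous_const).abs continuous_const
    · exact isClosed_eq (hci _) continuous_const
    · exact isClosed_eq (hci _) continuous_const
  have hlsc : LowerSemicontinuousOn
      (fun v => graphLength (sampleMin x) (sampleMax x) (interp z v m)) K := by
    refine LowerSemicontinuous.lowerSemicontinuousOn (fun v c hc => ?_) K
    refine eVariationOn.lowerSemicontinuous_aux (fun y _ => ?_) hc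
    exact ((WithLp.prod_continuous_toLp 2 ℝ ℝ).comp
      (continuous_const.prodMk (continuous_interp_values z m y))).tendsto v
  obtain ⟨v, hv, hmin⟩ := hlsc.exists_isMinOn ⟨_, hvals T₀ hT₀⟩ hcompact
  refine ⟨_, hv.2, fun T hT => (hmin (hvals T hT)).trans ?_⟩
  exact (hT.interp hz h0 hm hobs fun i hi => by rw [min_eq_left hi]).2

end Strings

/-! ### Step functions and their extreme intervals -/

/-- The number of the piece of the line containing `y`: `0` on `(-∞, z 0)`, `1` on `[z 0, z 1]`,
`i` on `(z (i - 1), z i]` for `2 ≤ i ≤ M`, and `M + 1` on `(z M, ∞)`. -/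
def knotIndex (z : ℕ → ℝ) (M : ℕ) (y : ℝ) : ℕ :=
  if y < z 0 then 0 else 1 + ((Finset.Icc 1 M).filter fun j => z j < y).card

section KnotIndex

variable {z : ℕ → ℝ} {M : ℕ}

theorem knotIndex_eq_zero {y : ℝ} (h : y < z 0) : knotIndex z M y = 0 := by simp [knotIndex, h]

theorem one_le_knotIndex {y : ℝ} (h : z 0 ≤ y) : 1 ≤ knotIndex z M y := by
  simp [knotIndex, not_lt.2 h]

theorem knotIndex_le (y : ℝ) : knotIndex z M y ≤ M + 1 := by
  unfold knotIndex
  split_ifs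
  · omega
  · have := Finset.card_filter_le (Finset.Icc 1 M) fun j => z j < y
    simp at this
    omega

theorem knotIndex_mono : Monotone (knotIndex z M) := fun y y' h => by
  unfold knotIndex
  split_ifs with h1 h2 h2
  · exact le_rfl
  · omega
  · exact absurd (h.trans_lt h2) h1
  · refine Nat.add_le_add_left (Finset.card_le_card fun j hj => ?_) 1
    rw [Finset.mem_filter] at hj ⊢
    exact ⟨hj.1, hj.2.trans_le h⟩

theorem knotIndex_ge (hz : StrictMono z) {j : ℕ} (hj : j ≤ M) {y : ℝ} (h : z j < y) :
    j + 1 ≤ knotIndex z M y := by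
  unfold knotIndex
  rw [if_neg (not_lt.2 ((hz.monotone j.zero_le).trans h.le)), add_comm]
  refine Nat.add_le_add_left ?_ 1
  have : Finset.Icc 1 j ⊆ (Finset.Icc 1 M).filter fun j => z j < y := fun i hi => by
    rw [Finset.mem_Icc] at hi
    rw [Finset.mem_filter, Finset.mem_Icc]
    exact ⟨⟨hi.1, hi.2.trans hj⟩, (hz.monotone hi.2).trans_lt h⟩
  simpa using Finset.card_le_card this

theorem knotIndex_le_of_le (hz : StrictMono z) {j : ℕ} (hj : 1 ≤ j) {y : ℝ}
    (h : y ≤ z j) : knotIndex z M y ≤ j := by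
  unfold knotIndex
  split_ifs
  · omega
  · have : (Finset.Icc 1 M).filter (fun j => z j < y) ⊆ Finset.Icc 1 (j - 1) := fun i hi => by
      rw [Finset.mem_filter, Finset.mem_Icc] at hi
      rw [Finset.mem_Icc]
      have := hz.lt_iff_lt.1 (hi.2.trans_le h)
      omega
    have := Finset.card_le_card this
    simp at this
    omega

theorem knotIndex_eq (hz : StrictMono z) {i : ℕ} (hi : i < M) {y : ℝ}
    (h : y ∈ Ioc (z i) (z (i + 1))) : knotIndex z M y = i + 1 :=
  le_antisymm (knotIndex_le_of_le hz (by omega) h.2) (knotIndex_ge hz hi.le h.1)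

theorem knotIndex_eq_last (hz : StrictMono z) {y : ℝ} (h : z M < y) : knotIndex z M y = M + 1 :=
  le_antisymm (knotIndex_le y) (knotIndex_ge hz le_rfl h)

theorem knotIndex_zero_knot (hz : StrictMono z) : knotIndex z M (z 0) = 1 :=
  le_antisymm (knotIndex_le_of_le hz le_rfl (hz.monotone (Nat.zero_le 1)))
    (one_le_knotIndex le_rfl)

/-- A point of the `(i + 1)`-st piece lies in `[z i, z (i + 1)]`. -/
theorem mem_Icc_of_knotIndex_eq (hz : StrictMono z) {i : ℕ} (hi : i < M) {y : ℝ}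
    (h : knotIndex z M y = i + 1) : y ∈ Icc (z i) (z (i + 1)) := by
  constructor
  · by_contra hlt
    rw [not_le] at hlt
    rcases Nat.eq_zero_or_pos i with rfl | hi0
    · rw [knotIndex_eq_zero hlt] at h; omega
    · have := knotIndex_le_of_le (M := M) hz hi0 hlt.le; omega
  · by_contra hlt
    have := knotIndex_ge hz (show i + 1 ≤ M from hi) (not_le.1 hlt)
    omega

/-- Consecutive pieces are adjacent. -/
theorem exists_knotIndex_adjacent (hz : StrictMono z) {i : ℕ} (hi : i ≤ M) {η : ℝ} (hη : 0 < η) :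
    ∃ y y', knotIndex z M y = i ∧ knotIndex z M y' = i + 1 ∧ dist y y' < η := by
  rcases Nat.eq_zero_or_pos i with rfl | h0
  · refine ⟨z 0 - η / 2, z 0, knotIndex_eq_zero (by linarith), knotIndex_zero_knot hz, ?_⟩
    rw [Real.dist_eq, sub_sub_cancel_left, abs_neg, abs_of_pos (half_pos hη)]
    linarith
  · have h1 : knotIndex z M (z i) = i := by
      have := knotIndex_eq (M := M) hz (i := i - 1) (by omega) (y := z i)
        ⟨hz (by omega), hz.monotone (by omega)⟩
      omega
    have hgap : z i < z (i + 1) := hz i.lt_succ_self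
    refine ⟨z i, z i + min (η / 2) (z (i + 1) - z i), h1, ?_, ?_⟩
    · have hpos : 0 < min (η / 2) (z (i + 1) - z i) := lt_min (half_pos hη) (sub_pos.2 hgap)
      rcases hi.lt_or_eq with h | rfl
      · refine knotIndex_eq hz h ⟨by linarith, ?_⟩
        linarith [min_le_right (η / 2) (z (i + 1) - z i)]
      · exact knotIndex_eq_last hz (by linarith)
    · have hpos : 0 < min (η / 2) (z (i + 1) - z i) := lt_min (half_pos hη) (sub_pos.2 hgap)
      rw [Real.dist_eq, sub_add_cancel_left, abs_neg, abs_of_pos hpos]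
      linarith [min_le_left (η / 2) (z (i + 1) - z i)]

/-- Only the two neighbouring pieces come close to a given bounded piece. -/
theorem exists_thickening_knotIndex (hz : StrictMono z) {i : ℕ} (hi : i < M) :
    ∃ η > 0, ∀ y ∈ Metric.thickening η (knotIndex z M ⁻¹' {i + 1}),
      i ≤ knotIndex z M y ∧ knotIndex z M y ≤ i + 2 := by
  have g1 : 0 < z i - z (i - 1) + (if i = 0 then 1 else 0) := by
    split_ifs with h
    · subst h; simp
    · simpa using hz (by omega : i - 1 < i)
  have g2 : 0 < z (i + 2) - z (i + 1) := sub_pos.2 (hz (by omega))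
  refine ⟨_, lt_min g1 g2, fun y' hy' => ?_⟩
  obtain ⟨y, hy, hd⟩ := Metric.mem_thickening_iff.1 hy'
  obtain ⟨hy1, hy2⟩ := mem_Icc_of_knotIndex_eq hz hi hy
  rw [Real.dist_eq, abs_lt] at hd
  have e1 := min_le_left (z i - z (i - 1) + (if i = 0 then 1 else 0)) (z (i + 2) - z (i + 1))
  have e2 := min_le_right (z i - z (i - 1) + (if i = 0 then 1 else 0)) (z (i + 2) - z (i + 1))
  constructor
  · rcases Nat.eq_zero_or_pos i with h0 | h0
    · omega
    · rw [if_neg h0.ne'] at e1 hd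
      have := knotIndex_ge (M := M) hz (j := i - 1) (by omega) (y := y') (by linarith [hd.1])
      omega
  · exact knotIndex_le_of_le hz (by omega) (by linarith [hd.2])

theorem isLocalMaxInterval_iff (hz : StrictMono z) {s : ℝ → ℝ} {e : ℕ → ℝ}
    (hs : ∀ y, s y = e (knotIndex z M y)) (he : ∀ i ≤ M, e i ≠ e (i + 1)) (A : Set ℝ) :
    IsLocalMaxInterval s A ↔
      ∃ i < M, e i < e (i + 1) ∧ e (i + 2) < e (i + 1) ∧ A = knotIndex z M ⁻¹' {i + 1} := by
  constructor
  · rintro ⟨⟨y, hy⟩, hconn, hbdd, c, hc, η, hη, hlt⟩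
    set i := knotIndex z M y with hi
    have hci : c = e i := by rw [← hc y hy, hs]
    -- Points of the same piece as `y` cannot be separated from `A`.
    have hsub : knotIndex z M ⁻¹' {i} ⊆ A := by
      intro y' hy'
      have hconst : ∀ w ∈ uIcc y y', s w = c := by
        intro w hw
        rw [hs, hci]
        congr 1
        have h1 := knotIndex_mono (z := z) (M := M) hw.1
        have h2 := knotIndex_mono (z := z) (M := M) hw.2
        rw [knotIndex_mono.map_min, ← hi, show knotIndex z M y' = i from hy', min_self] at h1
        rw [knotIndex_mono.map_max, ← hi, show knotIndex z M y' = i from hy', max_self] at h2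
        exact le_antisymm h2 h1
      have hA : ∀ w ∈ uIcc y y', w ∈ Metric.thickening η A → w ∈ A := fun w hw hwη => by
        by_contra hwA
        exact (hlt w hwη hwA).ne (hconst w hw)
      have hseg := isPreconnected_uIcc (a := y) (b := y') |>.subset_of_closure_inter_subset
        (u := Metric.thickening (η / 2) A) Metric.isOpen_thickening
        ⟨y, left_mem_uIcc, Metric.self_subset_thickening (half_pos hη) A hy⟩ (by
          rintro w ⟨hw1, hw2⟩
          refine Metric.self_subset_thickening (half_pos hη) A (hA w hw2 ?_)
          exact Metric.cthickening_subset_thickening' hη (half_lt_self hη) A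
            (Metric.closure_thickening_subset_cthickening _ _ hw1))
      exact hA y' right_mem_uIcc
        (Metric.thickening_mono (half_le_self hη.le) A (hseg right_mem_uIcc))
    -- A point of `A` in another piece would put a point of an adjacent piece into `A`.
    have hneigh : ∀ w ∈ A, knotIndex z M w = i := by
      intro w hw
      have hiw : e (knotIndex z M w) = e i := by rw [← hs, hc w hw, hci]
      rcases lt_trichotomy (knotIndex z M w) i with h | h | h
      · exfalso
        have hiM : i ≤ M + 1 := knotIndex_le y
        obtain ⟨v, -, hv, -, -⟩ :=
          exists_knotIndex_adjacent (M := M) hz (i := i - 1) (by omega) one_pos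
        have hvy : v ≤ y := by
          refine (knotIndex_mono.reflect_lt (?_ : knotIndex z M v < knotIndex z M y)).le
          omega
        have e1 := he (i - 1) (by omega)
        rw [Nat.sub_add_cancel (by omega)] at e1
        by_cases hwv : w ≤ v
        · apply e1
          rw [← hci, ← hc v (hconn.out hw hy ⟨hwv, hvy⟩), hs, hv]
        · have h1 := knotIndex_mono (z := z) (M := M) (not_le.1 hwv).le
          apply e1
          rw [← hiw]; congr 1; omega
      · exact h
      · exfalso
        have hiM : knotIndex z M w ≤ M + 1 := knotIndex_le w
        obtain ⟨-, v, -, hv, -⟩ :=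
          exists_knotIndex_adjacent (M := M) hz (i := i) (by omega) one_pos
        have hvy : y ≤ v := by
          refine (knotIndex_mono.reflect_lt (?_ : knotIndex z M y < knotIndex z M v)).le
          omega
        by_cases hvw : v ≤ w
        · have e1 := he i (by omega)
          apply e1
          rw [← hci, ← hc v (hconn.out hy hw ⟨hvy, hvw⟩), hs, hv]
        · have h1 := knotIndex_mono (z := z) (M := M) (not_le.1 hvw).le
          have e1 := he i (by omega)
          apply e1
          rw [← hiw]; congr 1; omega
    have hAeq : A = knotIndex z M ⁻¹' {i} := Subset.antisymm (fun w hw => hneigh w hw) hsub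
    obtain ⟨B, hB⟩ := hbdd.subset_closedBall 0
    have hiM : i ≤ M + 1 := knotIndex_le y
    have hi0 : i ≠ 0 := fun h0 => by
      have hlow : min (z 0 - 1) (-B - 1) ∈ A := hsub (by
        rw [mem_preimage, mem_singleton_iff, h0]
        exact knotIndex_eq_zero (by linarith [min_le_left (z 0 - 1) (-B - 1)]))
      have := hB hlow
      rw [Metric.mem_closedBall, Real.dist_eq, sub_zero, abs_le] at this
      linarith [min_le_right (z 0 - 1) (-B - 1), this.1]
    have hiL : i ≠ M + 1 := fun h0 => by
      have hup : max (z M + 1) (B + 1) ∈ A := hsub (by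
        rw [mem_preimage, mem_singleton_iff, h0]
        exact knotIndex_eq_last hz (by linarith [le_max_left (z M + 1) (B + 1)]))
      have := hB hup
      rw [Metric.mem_closedBall, Real.dist_eq, sub_zero, abs_le] at this
      linarith [le_max_right (z M + 1) (B + 1), this.2]
    obtain ⟨j, hj⟩ : ∃ j, i = j + 1 := ⟨i - 1, by omega⟩
    refine ⟨j, by omega, ?_, ?_, by rw [hAeq, hj]⟩
    · obtain ⟨w, w', hw, hw', hd⟩ := exists_knotIndex_adjacent (M := M) hz (i := j) (by omega) hη
      have := hlt w (Metric.mem_thickening_iff.2 ⟨w', hsub (by simp [hw', hj]), hd⟩) fun hwA => by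
        have := hneigh w hwA; omega
      rwa [hs, hw, hci, hj] at this
    · obtain ⟨w, w', hw, hw', hd⟩ := exists_knotIndex_adjacent (M := M) hz (i := j + 1) (by omega) hη
      have := hlt w' (Metric.mem_thickening_iff.2 ⟨w, hsub (by simp [hw, hj]), by rwa [dist_comm]⟩)
        fun hwA => by have := hneigh w' hwA; omega
      rwa [hs, hw', hci, hj] at this
  · rintro ⟨i, hi, h1, h2, rfl⟩
    obtain ⟨η, hη, hth⟩ := exists_thickening_knotIndex hz hi
    refine ⟨?_, ?_, ?_, e (i + 1), ?_, η, hη, ?_⟩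
    · exact ⟨z (i + 1), knotIndex_eq hz hi ⟨hz i.lt_succ_self, le_rfl⟩⟩
    · refine ⟨fun y hy y' hy' w hw => ?_⟩
      have hy : knotIndex z M y = i + 1 := hy
      have hy' : knotIndex z M y' = i + 1 := hy'
      have a1 := knotIndex_mono (z := z) (M := M) hw.1
      have a2 := knotIndex_mono (z := z) (M := M) hw.2
      exact (show knotIndex z M w = i + 1 by omega)
    · exact (Metric.isBounded_Icc (z i) (z (i + 1))).subset fun y hy =>
        mem_Icc_of_knotIndex_eq hz hi hy
    · intro y hy; rw [hs, show knotIndex z M y = i + 1 from hy]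
    · intro y hy hne
      have hne : knotIndex z M y ≠ i + 1 := hne
      obtain ⟨a1, a2⟩ := hth y hy
      rw [hs]
      rcases (show knotIndex z M y = i ∨ knotIndex z M y = i + 2 by omega) with h | h <;> rw [h]
      · exact h1
      · exact h2

theorem isLocalMinInterval_iff_neg (s : ℝ → ℝ) (A : Set ℝ) :
    IsLocalMinInterval s A ↔ IsLocalMaxInterval (fun y => -s y) A := by
  unfold IsLocalMinInterval IsLocalMaxInterval
  refine and_congr_right fun _ => and_congr_right fun _ => and_congr_right fun _ => ?_
  constructor
  · rintro ⟨c, hc, η, hη, h⟩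
    exact ⟨-c, fun y hy => congrArg Neg.neg (hc y hy), η, hη, fun y hy hy' => neg_lt_neg (h y hy hy')⟩
  · rintro ⟨c, hc, η, hη, h⟩
    exact ⟨-c, fun y hy => by rw [← hc y hy, neg_neg], η, hη, fun y hy hy' => by
      have := h y hy hy'; linarith⟩

/-- The value at `i + 1` is a strict local extremum of the sequence `e`. -/
def IsExtremeIndex (e : ℕ → ℝ) (i : ℕ) : Prop :=
  (e i < e (i + 1) ∧ e (i + 2) < e (i + 1)) ∨ (e (i + 1) < e i ∧ e (i + 1) < e (i + 2))

theorem isExtremeIndex_neg (e : ℕ → ℝ) (i : ℕ) :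
    IsExtremeIndex (fun j => -e j) i ↔ IsExtremeIndex e i := by
  unfold IsExtremeIndex
  simp only [neg_lt_neg_iff]
  tauto

/-- The extreme intervals of a step function are its locally extreme pieces. -/
theorem mem_extremeIntervals_iff (hz : StrictMono z) {s : ℝ → ℝ} {e : ℕ → ℝ}
    (hs : ∀ y, s y = e (knotIndex z M y)) (he : ∀ i ≤ M, e i ≠ e (i + 1)) (A : Set ℝ) :
    A ∈ extremeIntervals s ↔
      ∃ i < M, IsExtremeIndex e i ∧ A = knotIndex z M ⁻¹' {i + 1} := by
  have hmin := isLocalMaxInterval_iff (M := M) hz (s := fun y => -s y) (e := fun i => -e i)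
    (fun y => by rw [hs]) (fun i hi h => he i hi (neg_injective h)) A
  rw [← isLocalMinInterval_iff_neg] at hmin
  change IsLocalMaxInterval s A ∨ IsLocalMinInterval s A ↔ _
  rw [hmin, isLocalMaxInterval_iff hz hs he]
  unfold IsExtremeIndex
  constructor
  · rintro (⟨i, hi, h1, h2, h3⟩ | ⟨i, hi, h1, h2, h3⟩)
    · exact ⟨i, hi, Or.inl ⟨h1, h2⟩, h3⟩
    · exact ⟨i, hi, Or.inr ⟨by linarith, by linarith⟩, h3⟩
  · rintro ⟨i, hi, h1 | h1, h3⟩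
    · exact Or.inl ⟨i, hi, h1.1, h1.2, h3⟩
    · exact Or.inr ⟨i, hi, by linarith [h1.1], by linarith [h1.2], h3⟩

end KnotIndex

/-! ### The shape of the taut string -/

section Sample

variable {n : ℕ} {x : Fin n → ℝ} {ε : ℝ} {F : ℝ → ℝ}

theorem sampleMin_le (x : Fin n → ℝ) (i : Fin n) : sampleMin x ≤ x i :=
  ciInf_le (finite_range x).bddBelow i

theorem le_sampleMax (x : Fin n → ℝ) (i : Fin n) : x i ≤ sampleMax x :=
  le_ciSup (finite_range x).bddAbove i

theorem empCDF_of_lt_sampleMin {y : ℝ} (h : y < sampleMin x) : empCDF x y = 0 := by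
  have : (Finset.univ.filter fun i => x i ≤ y) = ∅ := by
    ext i; simpa using h.trans_le (sampleMin_le x i)
  simp [empCDF, this]

theorem empCDF_of_sampleMax_le (hn : 0 < n) {y : ℝ} (h : sampleMax x ≤ y) : empCDF x y = 1 := by
  have : (Finset.univ.filter fun i => x i ≤ y) = Finset.univ := by
    ext i; simpa using (le_sampleMax x i).trans h
  have hn' : (n : ℝ) ≠ 0 := by exact_mod_cast hn.ne'
  simp [empCDF, this, hn']

/-- A continuous distribution function within `ε / 4` of the empirical one has little mass to
the left of the smallest observation. -/
theorem le_at_sampleMin (hFc : Continuous F) (hdev : ∀ y, |empCDF x y - F y| ≤ ε / 4) :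
    F (sampleMin x) ≤ ε / 4 := by
  refine le_of_tendsto ((hFc.tendsto _).mono_left
    (nhdsWithin_le_nhds : 𝓝[<] sampleMin x ≤ 𝓝 (sampleMin x))) ?_
  filter_upwards [self_mem_nhdsWithin] with y hy
  have := (abs_le.1 (hdev y)).1
  rw [empCDF_of_lt_sampleMin hy] at this
  linarith

theorem ge_at_sampleMax (hn : 0 < n) (hdev : ∀ y, |empCDF x y - F y| ≤ ε / 4) :
    1 - ε / 4 ≤ F (sampleMax x) := by
  have := (abs_le.1 (hdev (sampleMax x))).2
  rw [empCDF_of_sampleMax_le hn le_rfl] at this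
  linarith

theorem pos_of_deviation (hF1 : Tendsto F atTop (𝓝 1)) (hε : ε < 1)
    (hdev : ∀ y, |empCDF x y - F y| ≤ ε / 4) : 0 < n := by
  rcases Nat.eq_zero_or_pos n with rfl | h
  · have : (1 : ℝ) ≤ ε / 4 := by
      refine le_of_tendsto hF1 (Eventually.of_forall fun y => ?_)
      have := (abs_le.1 (hdev y)).1
      simp [empCDF] at this
      linarith
    linarith
  · exact h

theorem sampleMin_lt_sampleMax (hFc : Continuous F) (hn : 0 < n) (hε : ε < 1)
    (hdev : ∀ y, |empCDF x y - F y| ≤ ε / 4) : sampleMin x < sampleMax x := by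
  refine lt_of_le_of_ne ((sampleMin_le x ⟨0, hn⟩).trans (le_sampleMax x ⟨0, hn⟩)) fun h => ?_
  have h1 := le_at_sampleMin hFc hdev
  have h2 := ge_at_sampleMax hn hdev
  rw [h] at h1
  linarith

/-- The tube contains a string: the distribution function conditioned on the range of the
sample. -/
theorem exists_isTubeString (hFc : Continuous F) (hFm : Monotone F) (hF0 : ∀ y, 0 ≤ F y)
    (hF1 : ∀ y, F y ≤ 1) (hn : 0 < n) (hε0 : 0 < ε) (hε : ε < 1)
    (hdev : ∀ y, |empCDF x y - F y| ≤ ε / 4) :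
    IsTubeString x ε fun y => (F y - F (sampleMin x)) / (F (sampleMax x) - F (sampleMin x)) := by
  have h1 := le_at_sampleMin hFc hdev
  have h2 := ge_at_sampleMax hn hdev
  have hpos : 0 < F (sampleMax x) - F (sampleMin x) := by linarith
  refine ⟨?_, ?_, fun y hy => ?_, by simp, div_self hpos.ne'⟩
  · exact ((hFc.sub continuous_const).div_const _).continuousOn
  · intro y _ y' _ h
    exact div_le_div_of_nonneg_right (sub_le_sub_right (hFm h) _) hpos.le
  · have h3 := abs_le.1 (hdev y)
    have ha := hF0 (sampleMin x)
    have hb := hF1 (sampleMax x)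
    have hy1 := hFm hy.1
    have hy2 := hFm hy.2
    have key : |(F y - F (sampleMin x)) / (F (sampleMax x) - F (sampleMin x)) - F y| ≤ ε / 2 := by
      rw [abs_le]
      constructor
      · rw [← sub_nonneg, sub_neg_eq_add, sub_add, ← sub_nonneg]
        have : F y - ε / 2 ≤
            (F y - F (sampleMin x)) / (F (sampleMax x) - F (sampleMin x)) := by
          rw [le_div_iff₀ hpos]
          nlinarith [hF0 y, hF1 y]
        linarith
      · rw [sub_le_iff_le_add, div_le_iff₀ hpos]
        nlinarith [hF0 y, hF1 y]
    have h4 := abs_le.1 key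
    rw [abs_le]
    constructor <;> linarith [h3.1, h3.2, h4.1, h4.2]

variable {S : ℝ → ℝ}

/-- `S` is the polygon over the knots `z 0 < … < z M` with slopes `d 0, …, d (M - 1)`. -/
structure IsPolygon (S : ℝ → ℝ) (z d : ℕ → ℝ) (M : ℕ) : Prop where
  strictMono : StrictMono z
  affine : ∀ i < M, ∀ y ∈ Icc (z i) (z (i + 1)), S y = S (z i) + d i * (y - z i)

/-- The taut string is a polygon with vertices at observations. -/
theorem IsTautString.exists_isPolygon (hS : IsTautString x ε S)
    (hab : sampleMin x < sampleMax x) :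
    ∃ M z d, IsPolygon S z d M ∧ z 0 = sampleMin x ∧ z M = sampleMax x := by
  obtain ⟨m, z, hz, h0, hm, hobs⟩ := exists_knots hab (Finset.univ.image x)
  refine ⟨m, z, fun i => (S (z (i + 1)) - S (z i)) / (z (i + 1) - z i), ⟨hz, fun i hi => ?_⟩, h0, hm⟩
  have hu : sampleMin x ≤ z i := h0 ▸ hz.monotone i.zero_le
  have hv : z (i + 1) ≤ sampleMax x := hm ▸ hz.monotone hi
  have huv : z i < z (i + 1) := hz i.lt_succ_self
  replace hobs : ∀ l, ¬ (z i < x l ∧ x l < z (i + 1)) := fun l =>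
    hobs i hi (x l) (Finset.mem_image_of_mem _ (Finset.mem_univ l))
  obtain ⟨h1, h2⟩ := hS.1.le_of_no_obs hu huv hv hobs
  have hmono := monotone_chord huv.le (hS.1.monotoneOn ⟨hu, huv.le.trans hv⟩
    ⟨hu.trans huv.le, hv⟩ huv.le)
  refine hS.eq_chord hu huv hv fun y hy => ?_
  rcases hy.2.lt_or_eq with h | rfl
  · rw [empCDF_eq_of_no_obs hy.1 fun l hl => le_of_not_gt fun hul => hobs l ⟨hul, hl.trans_lt h⟩,
      abs_le]
    have h3 := hmono hy.1
    have h4 := hmono hy.2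
    rw [chord_left] at h3
    rw [chord_right S huv] at h4
    constructor <;> linarith
  · rw [chord_right S huv]; exact hS.1.mem_tube _ ⟨hu.trans huv.le, hv⟩

/-- A polygon has a representation in which every interior knot is a kink. -/
theorem IsPolygon.exists_reduced {z d : ℕ → ℝ} {M : ℕ} (h : IsPolygon S z d M) :
    ∃ M' z' d', IsPolygon S z' d' M' ∧ z' 0 = z 0 ∧ z' M' = z M ∧
      ∀ i, i + 1 < M' → d' i ≠ d' (i + 1) := by
  induction M using Nat.strong_induction_on generalizing z d with
  | _ M ih =>
    by_cases hred : ∀ i, i + 1 < M → d i ≠ d (i + 1)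
    · exact ⟨M, z, d, h, rfl, rfl, hred⟩
    push Not at hred
    obtain ⟨i, hi, hd⟩ := hred
    -- The knot `i + 1` is removed.
    set φ : ℕ → ℕ := fun j => if j ≤ i then j else j + 1 with hφ
    have hφm : StrictMono φ := strictMono_nat_of_lt_succ fun j => by
      simp only [hφ]; split_ifs <;> omega
    have hz := h.strictMono
    have hpoly : IsPolygon S (z ∘ φ) (d ∘ φ) (M - 1) := by
      refine ⟨hz.comp hφm, fun j hj y hy => ?_⟩
      simp only [Function.comp, hφ] at hy ⊢
      rcases lt_trichotomy j i with hji | rfl | hji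
      · rw [if_pos hji.le, if_pos (by omega : j + 1 ≤ i)] at hy
        rw [if_pos hji.le]
        exact h.affine j (by omega) y hy
      · rw [if_pos le_rfl, if_neg (by omega)] at hy
        rw [if_pos le_rfl]
        have hlt : z j < z (j + 1) := hz j.lt_succ_self
        rcases le_total y (z (j + 1)) with h1 | h1
        · exact h.affine j (by omega) y ⟨hy.1, h1⟩
        · rw [h.affine (j + 1) hi y ⟨h1, hy.2⟩,
            h.affine j (by omega) (z (j + 1)) ⟨hlt.le, le_rfl⟩, hd]
          ring
      · rw [if_neg (by omega), if_neg (by omega)] at hy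
        rw [if_neg (by omega)]
        exact h.affine (j + 1) (by omega) y hy
    obtain ⟨M', z', d', h1, h2, h3, h4⟩ := ih (M - 1) (by omega) hpoly
    refine ⟨M', z', d', h1, ?_, ?_, h4⟩
    · rw [h2]; simp [hφ]
    · rw [h3]; simp only [Function.comp, hφ]; rw [if_neg (by omega)]; congr 1; omega

/-- The chord cutting a corner of slopes `c`, `c'` symmetrically. -/
theorem chord_corner {w c c' h y : ℝ} (hh : 0 < h) (h1 : S (w - h) = S w - c * h)
    (h2 : S (w + h) = S w + c' * h) :
    chord S (w - h) (w + h) y = S w + (c' - c) / 2 * h + (c + c') / 2 * (y - w) := by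
  unfold chord
  rw [h1, h2, show w + h - (w - h) = 2 * h by ring]
  field_simp
  ring

/-- Where the taut string bends upwards it touches the upper boundary of the tube, where it
bends downwards it touches the lower boundary; otherwise the corner could be cut. -/
theorem IsTautString.kink (hS : IsTautString x ε S) (hFc : Continuous F)
    (hdev : ∀ y, |empCDF x y - F y| ≤ ε / 4) {w c c' r : ℝ} (hr : 0 < r)
    (hl : sampleMin x ≤ w - r) (hu : w + r ≤ sampleMax x)
    (h1 : ∀ y ∈ Icc (w - r) w, S y = S w + c * (y - w))
    (h2 : ∀ y ∈ Icc w (w + r), S y = S w + c' * (y - w)) :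
    (c < c' → F w + 3 * ε / 4 ≤ S w) ∧ (c' < c → S w ≤ F w - 3 * ε / 4) := by
  -- A corner cut at any small scale would leave the tube.
  have hcut : ∀ h, 0 < h → h ≤ r → c ≠ c' →
      ¬ ∀ y ∈ Icc (w - h) (w + h), |chord S (w - h) (w + h) y - empCDF x y| ≤ ε := by
    intro h hh hhr hne htube
    have e1 : S (w - h) = S w - c * h := by
      rw [h1 _ ⟨by linarith, by linarith⟩]; ring
    have e2 : S (w + h) = S w + c' * h := by
      rw [h2 _ ⟨by linarith, by linarith⟩]; ring
    have := hS.eq_chord (by linarith) (by linarith) (by linarith) htube w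
      ⟨by linarith, by linarith⟩
    rw [chord_corner hh e1 e2, sub_self, mul_zero, add_zero] at this
    have h3 : (c' - c) / 2 * h = 0 := by linarith
    rcases mul_eq_zero.1 h3 with h4 | h4
    · exact hne (by linarith)
    · exact hh.ne' h4
  have hchord : ∀ h, 0 < h → h ≤ r → ∀ y, chord S (w - h) (w + h) y
      = S w + (c' - c) / 2 * h + (c + c') / 2 * (y - w) := fun h hh hhr y =>
    chord_corner hh (by rw [h1 _ ⟨by linarith, by linarith⟩]; ring)
      (by rw [h2 _ ⟨by linarith, by linarith⟩]; ring)
  set C := |c| + |c'| with hC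
  have hC0 : 0 ≤ C := by positivity
  -- The chord stays within `C * h` of the vertex.
  have hnear : ∀ h, 0 < h → ∀ y ∈ Icc (w - h) (w + h),
      |(c' - c) / 2 * h + (c + c') / 2 * (y - w)| ≤ C * h := by
    intro h hh y hy
    have a1 : |y - w| ≤ h := abs_le.2 ⟨by linarith [hy.1], by linarith [hy.2]⟩
    have a2 : |(c' - c) / 2| ≤ C / 2 := by
      rw [abs_div, abs_two, hC]; gcongr; linarith [abs_sub c' c]
    have a3 : |(c + c') / 2| ≤ C / 2 := by
      rw [abs_div, abs_two, hC]; gcongr; exact abs_add_le _ _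
    calc _ ≤ |(c' - c) / 2| * |h| + |(c + c') / 2| * |y - w| := by
          rw [← abs_mul, ← abs_mul]; exact abs_add_le _ _
      _ ≤ C / 2 * h + C / 2 * h := by
          rw [abs_of_pos hh]; gcongr
      _ = C * h := by ring
  have hsmall : ∀ η > 0, ∃ h, 0 < h ∧ h ≤ r ∧ C * h < η ∧
      ∀ y ∈ Icc (w - h) (w + h), |F y - F w| < η := by
    intro η hη
    obtain ⟨ρ, hρ, hFρ⟩ := Metric.continuous_iff.1 hFc w η hη
    refine ⟨min r (min (ρ / 2) (η / (C + 1) / 2)), by positivity, min_le_left _ _, ?_, fun y hy => ?_⟩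
    · have b1 : min r (min (ρ / 2) (η / (C + 1) / 2)) ≤ η / (C + 1) / 2 :=
        (min_le_right _ _).trans (min_le_right _ _)
      calc _ ≤ C * (η / (C + 1) / 2) := by gcongr
        _ = (C / (C + 1)) * (η / 2) := by ring
        _ ≤ 1 * (η / 2) := by gcongr; rw [div_le_one (by positivity)]; linarith
        _ < η := by linarith
    · have b1 : min r (min (ρ / 2) (η / (C + 1) / 2)) ≤ ρ / 2 :=
        (min_le_right _ _).trans (min_le_left _ _)
      have := hFρ y (by
        rw [Real.dist_eq, abs_lt]
        constructor <;> linarith [hy.1, hy.2])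
      rwa [Real.dist_eq] at this
  have hmem : ∀ h, h ≤ r → ∀ y ∈ Icc (w - h) (w + h), y ∈ Icc (sampleMin x) (sampleMax x) :=
    fun h hh y hy => ⟨by linarith [hy.1], by linarith [hy.2]⟩
  constructor
  · intro hlt
    by_contra hcon
    rw [not_le] at hcon
    obtain ⟨h, hh, hhr, hη, hFη⟩ := hsmall ((F w + 3 * ε / 4 - S w) / 2) (by linarith)
    refine hcut h hh hhr hlt.ne fun y hy => ?_
    have b1 := (abs_le.1 (hdev y)).1
    have b2 := (abs_lt.1 (hFη y hy)).1
    have b3 := (abs_le.1 (hnear h hh y hy)).2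
    have b4 := (abs_le.1 (hS.1.mem_tube y (hmem h hhr y hy))).1
    have b5 : S y ≤ S w + (c' - c) / 2 * h + (c + c') / 2 * (y - w) := by
      rcases le_total y w with hyw | hyw
      · rw [h1 y ⟨by linarith [hy.1], hyw⟩]
        nlinarith [mul_nonneg (sub_pos.2 hlt).le (by linarith [hy.1] : 0 ≤ h + (y - w))]
      · rw [h2 y ⟨hyw, by linarith [hy.2]⟩]
        nlinarith [mul_nonneg (sub_pos.2 hlt).le (by linarith [hy.2] : 0 ≤ h - (y - w))]
    rw [hchord h hh hhr, abs_le]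
    constructor <;> linarith
  · intro hlt
    by_contra hcon
    rw [not_le] at hcon
    obtain ⟨h, hh, hhr, hη, hFη⟩ := hsmall ((S w - (F w - 3 * ε / 4)) / 2) (by linarith)
    refine hcut h hh hhr hlt.ne' fun y hy => ?_
    have b1 := (abs_le.1 (hdev y)).2
    have b2 := (abs_lt.1 (hFη y hy)).2
    have b3 := (abs_le.1 (hnear h hh y hy)).1
    have b4 := (abs_le.1 (hS.1.mem_tube y (hmem h hhr y hy))).2
    have b5 : S w + (c' - c) / 2 * h + (c + c') / 2 * (y - w) ≤ S y := by
      rcases le_total y w with hyw | hyw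
      · rw [h1 y ⟨by linarith [hy.1], hyw⟩]
        nlinarith [mul_nonneg (sub_pos.2 hlt).le (by linarith [hy.1] : 0 ≤ h + (y - w))]
      · rw [h2 y ⟨hyw, by linarith [hy.2]⟩]
        nlinarith [mul_nonneg (sub_pos.2 hlt).le (by linarith [hy.2] : 0 ≤ h - (y - w))]
    rw [hchord h hh hhr, abs_le]
    constructor <;> linarith

end Sample

/-- The slopes `d 0, …, d (M - 1)` of a polygon, preceded and followed by the slope `0`. -/
def slopes (d : ℕ → ℝ) (M : ℕ) : ℕ → ℝ
  | 0 => 0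
  | j + 1 => if j < M then d j else 0

theorem slopes_succ {d : ℕ → ℝ} {M j : ℕ} (h : j < M) : slopes d M (j + 1) = d j := by
  simp [slopes, h]

theorem slopes_last (d : ℕ → ℝ) (M : ℕ) : slopes d M (M + 1) = 0 := by simp [slopes]

theorem exists_mem_Ioc_knots {z : ℕ → ℝ} {m : ℕ} {y : ℝ} (h0 : z 0 < y) (hm : y ≤ z m) :
    ∃ i < m, y ∈ Ioc (z i) (z (i + 1)) := by
  induction m with
  | zero => exact absurd h0 (not_lt.2 hm)
  | succ m ih =>
    rcases le_or_gt y (z m) with h | h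
    · obtain ⟨i, hi, hy⟩ := ih h
      exact ⟨i, hi.trans m.lt_succ_self, hy⟩
    · exact ⟨m, m.lt_succ_self, h, hm⟩

theorem hasDerivAt_affine (s c w y : ℝ) : HasDerivAt (fun y' => s + c * (y' - w)) c y := by
  simpa using (((hasDerivAt_id y).sub_const w).const_mul c).const_add s

/-- The density of a polygon is the step function of its slopes. -/
theorem IsPolygon.stringDensity_eq {S : ℝ → ℝ} {z d : ℕ → ℝ} {M : ℕ} (h : IsPolygon S z d M)
    (hM : 0 < M) (y : ℝ) :
    stringDensity (z 0) (z M) S y = slopes d M (knotIndex z M y) := by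
  have hz := h.strictMono
  unfold stringDensity
  split_ifs with h1 h2
  · obtain ⟨i, hi, hy⟩ := exists_mem_Ioc_knots h1.1 h1.2
    rw [knotIndex_eq hz hi hy, slopes_succ hi]
    refine HasDerivWithinAt.derivWithin ?_ (uniqueDiffOn_Iic y y self_mem_Iic)
    refine (hasDerivAt_affine (S (z i)) (d i) (z i) y).hasDerivWithinAt.congr_of_eventuallyEq ?_
      (h.affine i hi y ⟨hy.1.le, hy.2⟩)
    filter_upwards [self_mem_nhdsWithin, mem_nhdsWithin_of_mem_nhds (Ioi_mem_nhds hy.1)]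
      with y' h1 h2
    exact h.affine i hi y' ⟨le_of_lt h2, le_trans h1 hy.2⟩
  · subst h2
    rw [knotIndex_zero_knot hz, slopes_succ hM]
    refine HasDerivWithinAt.derivWithin ?_ (uniqueDiffOn_Ici _ _ self_mem_Ici)
    have hlt : z 0 < z (0 + 1) := hz (Nat.lt_succ_self 0)
    refine (hasDerivAt_affine (S (z 0)) (d 0) (z 0) _).hasDerivWithinAt.congr_of_eventuallyEq ?_
      (h.affine 0 hM _ ⟨le_rfl, hlt.le⟩)
    filter_upwards [self_mem_nhdsWithin, mem_nhdsWithin_of_mem_nhds (Iio_mem_nhds hlt)]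
      with y' h1 h2
    exact h.affine 0 hM y' ⟨h1, le_of_lt h2⟩
  · rcases lt_or_ge y (z 0) with h3 | h3
    · rw [knotIndex_eq_zero h3]; rfl
    · have h4 : z 0 < y := lt_of_le_of_ne h3 (Ne.symm h2)
      have h5 : z M < y := not_le.1 fun h5 => h1 ⟨h4, h5⟩
      rw [knotIndex_eq_last hz h5, slopes_last]

/-- What the asymptotic analysis needs to know about a taut string: it is a polygon through the
points `(z i, v i)` with slopes `d i`, which is uniformly close to `F`, passes above `F` where it
bends upwards and below `F` where it bends downwards. -/
structure IsTautShape (F : ℝ → ℝ) (ε : ℝ) (z v d : ℕ → ℝ) (M : ℕ) : Prop where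
  strictMono : StrictMono z
  pos : 0 < M
  step : ∀ i < M, v (i + 1) = v i + d i * (z (i + 1) - z i)
  left_eq : v 0 = 0
  right_eq : v M = 1
  left_le : F (z 0) ≤ ε / 4
  right_ge : 1 - ε / 4 ≤ F (z M)
  slope_pos : ∀ i < M, 0 < d i
  slope_ne : ∀ i, i + 1 < M → d i ≠ d (i + 1)
  bend_up : ∀ i, i + 1 < M → d i < d (i + 1) → F (z (i + 1)) + 3 * ε / 4 ≤ v (i + 1)
  bend_down : ∀ i, i + 1 < M → d (i + 1) < d i → v (i + 1) ≤ F (z (i + 1)) - 3 * ε / 4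
  close : ∀ y, |interp z v M y - F y| ≤ 2 * ε

theorem interp_of_le {z : ℕ → ℝ} (hz : StrictMono z) (v : ℕ → ℝ) (m : ℕ) {y : ℝ} (hy : y ≤ z 0) :
    interp z v m y = v 0 := by
  unfold interp
  rw [Finset.sum_eq_zero, add_zero]
  intro j _
  rw [max_eq_left ((min_le_left _ _).trans (hy.trans (hz.monotone j.zero_le)))]
  simp

theorem IsTautString.exists_shape {n : ℕ} {x : Fin n → ℝ} {ε : ℝ} {F S : ℝ → ℝ}
    (hS : IsTautString x ε S) (hFc : Continuous F) (hFm : Monotone F) (hF0 : ∀ y, 0 ≤ F y)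
    (hF1 : ∀ y, F y ≤ 1) (hn : 0 < n) (hε0 : 0 < ε) (hε : ε < 1)
    (hdev : ∀ y, |empCDF x y - F y| ≤ ε / 4) :
    ∃ M z d, IsTautShape F ε z (fun i => S (z i)) d M ∧
      ∀ y, stringDensity (sampleMin x) (sampleMax x) S y = slopes d M (knotIndex z M y) := by
  have hab := sampleMin_lt_sampleMax hFc hn hε hdev
  obtain ⟨M₀, z₀, d₀, hp₀, h0₀, hm₀⟩ := hS.exists_isPolygon hab
  obtain ⟨M, z, d, hp, h0, hm, hne⟩ := hp₀.exists_reduced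
  rw [h0₀] at h0
  rw [hm₀] at hm
  have hz := hp.strictMono
  have hM : 0 < M := Nat.pos_of_ne_zero fun hM => by
    rw [hM, h0] at hm; exact hab.ne hm
  have hmem : ∀ i ≤ M, z i ∈ Icc (sampleMin x) (sampleMax x) := fun i hi => by
    rw [← h0, ← hm]; exact ⟨hz.monotone i.zero_le, hz.monotone hi⟩
  have hstep : ∀ i < M, S (z (i + 1)) = S (z i) + d i * (z (i + 1) - z i) := fun i hi =>
    hp.affine i hi _ ⟨hz.monotone i.le_succ, le_rfl⟩
  have hkink : ∀ i, i + 1 < M →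
      (d i < d (i + 1) → F (z (i + 1)) + 3 * ε / 4 ≤ S (z (i + 1))) ∧
      (d (i + 1) < d i → S (z (i + 1)) ≤ F (z (i + 1)) - 3 * ε / 4) := by
    intro i hi
    have g1 : z i < z (i + 1) := hz i.lt_succ_self
    have g2 : z (i + 1) < z (i + 2) := hz (Nat.lt_succ_self _)
    set r := min (z (i + 1) - z i) (z (i + 2) - z (i + 1)) with hr
    have r1 : r ≤ z (i + 1) - z i := min_le_left _ _
    have r2 : r ≤ z (i + 2) - z (i + 1) := min_le_right _ _
    refine hS.kink hFc hdev (w := z (i + 1)) (r := r) (lt_min (sub_pos.2 g1) (sub_pos.2 g2))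
      ?_ ?_ (fun y hy => ?_) fun y hy => ?_
    · linarith [(hmem i (by omega)).1]
    · linarith [(hmem (i + 2) (by omega)).2]
    · rw [hstep i (by omega), hp.affine i (by omega) y ⟨by linarith [hy.1], hy.2⟩]; ring
    · exact hp.affine (i + 1) hi y ⟨hy.1, by rw [add_assoc]; linarith [hy.2]⟩
  have hSm : ∀ i < M, S (z i) ≤ S (z (i + 1)) := fun i hi =>
    hS.1.monotoneOn (hmem i hi.le) (hmem (i + 1) hi) (hz.monotone i.le_succ)
  have hgap : ∀ i, 0 < z (i + 1) - z i := fun i => sub_pos.2 (hz i.lt_succ_self)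
  have hnonneg : ∀ i < M, 0 ≤ d i := fun i hi => by
    have := hSm i hi
    rw [hstep i hi] at this
    exact nonneg_of_mul_nonneg_left (by linarith) (hgap i)
  have hS0 : S (z 0) = 0 := by rw [h0]; exact hS.1.left_eq
  have hS1 : S (z M) = 1 := by rw [hm]; exact hS.1.right_eq
  -- A horizontal piece would start below `F` and end above it.
  have hpos : ∀ i < M, 0 < d i := by
    intro i hi
    refine (hnonneg i hi).lt_of_ne fun hzero => ?_
    have hflat : S (z (i + 1)) = S (z i) := by rw [hstep i hi, ← hzero]; ring
    have hFle := hFm (hz.monotone i.le_succ)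
    have hl : (i = 0 ∧ S (z i) = 0) ∨ S (z i) ≤ F (z i) - 3 * ε / 4 := by
      rcases Nat.eq_zero_or_pos i with rfl | hi0
      · exact Or.inl ⟨rfl, hS0⟩
      · obtain ⟨j, rfl⟩ : ∃ j, i = j + 1 := ⟨i - 1, by omega⟩
        refine Or.inr ((hkink j hi).2 ?_)
        exact lt_of_le_of_ne (hzero ▸ hnonneg j (by omega)) (hne j hi).symm
    have hr : (i + 1 = M ∧ S (z (i + 1)) = 1) ∨ F (z (i + 1)) + 3 * ε / 4 ≤ S (z (i + 1)) := by
      rcases (show i + 1 ≤ M from hi).eq_or_lt with hi1 | hi1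
      · exact Or.inl ⟨hi1, by rw [hi1, hS1]⟩
      · exact Or.inr ((hkink i hi1).1 (lt_of_le_of_ne (hzero ▸ hnonneg (i + 1) hi1) (hne i hi1)))
    rcases hl with ⟨-, hl⟩ | hl <;> rcases hr with ⟨-, hr⟩ | hr
    · linarith
    · linarith [hF0 (z (i + 1))]
    · linarith [hF1 (z i)]
    · linarith
  have hFl := le_at_sampleMin hFc hdev
  have hFr := ge_at_sampleMax hn hdev
  refine ⟨M, z, d, ⟨hz, hM, hstep, hS0, hS1, by rw [h0]; exact hFl, by rw [hm]; exact hFr, hpos,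
    hne, fun i hi => (hkink i hi).1, fun i hi => (hkink i hi).2, fun y => ?_⟩, fun y => ?_⟩
  · rcases lt_or_ge y (z 0) with h1 | h1
    · rw [interp_of_le hz _ M h1.le, hS0, zero_sub, abs_neg, abs_of_nonneg (hF0 y)]
      have := hFm h1.le
      rw [h0] at this
      linarith
    rcases le_or_gt (z M) y with h2 | h2
    · rw [interp_of_ge hz _ M h2, hS1, abs_of_nonneg (by linarith [hF1 y])]
      have := hFm h2
      rw [hm] at this
      linarith
    · obtain ⟨i, hi, hy⟩ := exists_mem_Ico_knots h1 h2
      rw [interp_of_mem hz _ hi ⟨hy.1, hy.2.le⟩, hstep i hi, add_sub_cancel_left,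
        mul_div_cancel_right₀ _ (hgap i).ne', ← hp.affine i hi y ⟨hy.1, hy.2.le⟩]
      have a1 := abs_le.1 (hS.1.mem_tube y ⟨h0 ▸ h1, hm ▸ h2.le⟩)
      have a2 := abs_le.1 (hdev y)
      rw [abs_le]
      constructor <;> linarith [a1.1, a1.2, a2.1, a2.2]
  · rw [← h0, ← hm]; exact hp.stringDensity_eq hM y

section Shape

variable {F : ℝ → ℝ} {ε : ℝ} {z v d : ℕ → ℝ} {M : ℕ}

theorem IsTautShape.slopes_ne (h : IsTautShape F ε z v d M) : ∀ i ≤ M,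
    slopes d M i ≠ slopes d M (i + 1) := by
  intro i hi
  rcases Nat.eq_zero_or_pos i with rfl | h0
  · rw [slopes_succ h.pos]; exact (h.slope_pos 0 h.pos).ne
  · obtain ⟨j, rfl⟩ : ∃ j, i = j + 1 := ⟨i - 1, by omega⟩
    rw [slopes_succ hi]
    rcases hi.lt_or_eq with h1 | h1
    · rw [slopes_succ h1]; exact h.slope_ne j h1
    · rw [h1, slopes_last]; exact (h.slope_pos j hi).ne'

theorem IsTautShape.slopes_nonneg (h : IsTautShape F ε z v d M) (i : ℕ) : 0 ≤ slopes d M i := by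
  cases i with
  | zero => exact le_rfl
  | succ j =>
    rcases lt_or_ge j M with hj | hj
    · rw [slopes_succ hj]; exact (h.slope_pos j hj).le
    · simp [slopes, not_lt.2 hj]

theorem sum_clamp {z : ℕ → ℝ} (hz : StrictMono z) (M : ℕ) (y : ℝ) :
    ∑ j ∈ Finset.range M, (max (z j) (min y (z (j + 1))) - z j)
      = max (z 0) (min y (z M)) - z 0 := by
  induction M with
  | zero => simp
  | succ M ih =>
    rw [Finset.sum_range_succ, ih]
    have h1 : z 0 ≤ z M := hz.monotone M.zero_le
    have h2 : z M < z (M + 1) := hz M.lt_succ_self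
    rcases le_total y (z M) with h | h
    · rw [min_eq_left h, min_eq_left (h.trans h2.le), max_eq_left h]; ring
    · rw [min_eq_right h, max_eq_right h1, max_eq_right (le_min h h2.le),
        max_eq_right (h1.trans (le_min h h2.le))]; ring

theorem IsTautShape.interp_sub (h : IsTautShape F ε z v d M) (u w : ℝ) :
    interp z v M w - interp z v M u = ∑ j ∈ Finset.range M,
      d j * (max (z j) (min w (z (j + 1))) - max (z j) (min u (z (j + 1)))) := by
  unfold interp
  rw [add_sub_add_left_eq_sub, ← Finset.sum_sub_distrib]
  refine Finset.sum_congr rfl fun j hj => ?_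
  have hgap : 0 < z (j + 1) - z j := sub_pos.2 (h.strictMono j.lt_succ_self)
  rw [h.step j (Finset.mem_range.1 hj), add_sub_cancel_left, mul_div_cancel_right₀ _ hgap.ne']
  ring

/-- A piece contributing to an increment over `[u, w]` meets `(u, w)`. -/
theorem exists_mem_piece (hz : StrictMono z) {j : ℕ} (hj : j < M) {u w : ℝ}
    (h : max (z j) (min u (z (j + 1))) < max (z j) (min w (z (j + 1)))) :
    ∃ y ∈ Ioo u w, slopes d M (knotIndex z M y) = d j := by
  have hgap : z j < z (j + 1) := hz j.lt_succ_self
  have hlt : max u (z j) < min w (z (j + 1)) := by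
    have hw : z j < min w (z (j + 1)) := by
      by_contra hcon
      rw [max_eq_left (not_lt.1 hcon)] at h
      exact absurd (le_max_left (z j) (min u (z (j + 1)))) (not_le.2 h)
    rw [max_eq_right hw.le] at h
    refine max_lt ?_ hw
    rcases le_total u (z (j + 1)) with hu | hu
    · rw [min_eq_left hu] at h; exact (le_max_right _ _).trans_lt h
    · rw [min_eq_right hu] at h
      exact absurd (min_le_right w (z (j + 1))) (not_le.2 ((le_max_right _ _).trans_lt h))
  obtain ⟨y, hy1, hy2⟩ := exists_between hlt
  rw [max_lt_iff] at hy1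
  rw [lt_min_iff] at hy2
  refine ⟨y, ⟨hy1.1, hy2.1⟩, ?_⟩
  rw [knotIndex_eq hz hj ⟨hy1.2, hy2.2.le⟩, slopes_succ hj]

theorem clamp_mono {a b u w : ℝ} (h : u ≤ w) : max a (min u b) ≤ max a (min w b) :=
  max_le_max le_rfl (min_le_min h le_rfl)

/-- Where the increment of the polygon exceeds `c (w - u)` some slope exceeds `c`. -/
theorem IsTautShape.exists_slope_gt (h : IsTautShape F ε z v d M) {u w c : ℝ} (huw : u < w)
    (hc : 0 ≤ c) (hinc : c * (w - u) < interp z v M w - interp z v M u) :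
    ∃ y ∈ Ioo u w, c < slopes d M (knotIndex z M y) := by
  by_contra hcon
  push Not at hcon
  refine absurd hinc (not_lt.2 ?_)
  rw [h.interp_sub]
  calc _ ≤ ∑ j ∈ Finset.range M,
        c * (max (z j) (min w (z (j + 1))) - max (z j) (min u (z (j + 1)))) := by
        refine Finset.sum_le_sum fun j hj => ?_
        rcases (clamp_mono (a := z j) (b := z (j + 1)) huw.le).eq_or_lt with heq | hlt
        · rw [heq]; simp
        · obtain ⟨y, hy, he⟩ := exists_mem_piece (d := d) h.strictMono (Finset.mem_range.1 hj) hlt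
          have := hcon y hy
          rw [he] at this
          exact mul_le_mul_of_nonneg_right this (sub_nonneg.2 hlt.le)
    _ = c * ((max (z 0) (min w (z M)) - z 0) - (max (z 0) (min u (z M)) - z 0)) := by
        rw [← sum_clamp h.strictMono, ← sum_clamp h.strictMono, ← Finset.sum_sub_distrib,
          Finset.mul_sum]
        exact Finset.sum_congr rfl fun j _ => by ring
    _ ≤ c * (w - u) := by
        refine mul_le_mul_of_nonneg_left ?_ hc
        simp only [max_def, min_def]
        split_ifs <;> linarith

/-- Where the increment of the polygon is below `c (w - u)` some slope is below `c`. -/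
theorem IsTautShape.exists_slope_lt (h : IsTautShape F ε z v d M) {u w c : ℝ} (huw : u < w)
    (hc : 0 < c) (hinc : interp z v M w - interp z v M u < c * (w - u)) :
    ∃ y ∈ Ioo u w, slopes d M (knotIndex z M y) < c := by
  by_contra hcon
  push Not at hcon
  refine absurd hinc (not_lt.2 ?_)
  -- The slope vanishes off `[z 0, z M]`.
  have hu : z 0 ≤ u := by
    by_contra hu
    obtain ⟨y, hy1, hy2⟩ := exists_between (lt_min huw (not_le.1 hu))
    rw [lt_min_iff] at hy2
    have := hcon y ⟨hy1, hy2.1⟩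
    rw [knotIndex_eq_zero hy2.2] at this
    exact absurd hc (not_lt.2 this)
  have hw : w ≤ z M := by
    by_contra hw
    obtain ⟨y, hy1, hy2⟩ := exists_between (max_lt huw (not_le.1 hw))
    rw [max_lt_iff] at hy1
    have := hcon y ⟨hy1.1, hy2⟩
    rw [knotIndex_eq_last h.strictMono hy1.2, slopes_last] at this
    exact absurd hc (not_lt.2 this)
  rw [h.interp_sub]
  calc c * (w - u)
      = c * ((max (z 0) (min w (z M)) - z 0) - (max (z 0) (min u (z M)) - z 0)) := by
        rw [min_eq_left hw, min_eq_left (huw.le.trans hw), max_eq_right hu,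
          max_eq_right (hu.trans huw.le)]; ring
    _ = ∑ j ∈ Finset.range M,
        c * (max (z j) (min w (z (j + 1))) - max (z j) (min u (z (j + 1)))) := by
        rw [← sum_clamp h.strictMono, ← sum_clamp h.strictMono, ← Finset.sum_sub_distrib,
          Finset.mul_sum]
        exact Finset.sum_congr rfl fun j _ => by ring
    _ ≤ _ := by
        refine Finset.sum_le_sum fun j hj => ?_
        rcases (clamp_mono (a := z j) (b := z (j + 1)) huw.le).eq_or_lt with heq | hlt
        · rw [heq]; simp
        · obtain ⟨y, hy, he⟩ := exists_mem_piece (d := d) h.strictMono (Finset.mem_range.1 hj) hlt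
          have := hcon y hy
          rw [he] at this
          exact mul_le_mul_of_nonneg_right this (sub_nonneg.2 hlt.le)

/-- On a locally maximal piece the average of the density exceeds the slope of the string, unless
the string is a single segment. -/
theorem IsTautShape.mass_gt (h : IsTautShape F ε z v d M) (hε : 0 < ε) (hM : 2 ≤ M) {i : ℕ}
    (hi : i < M) (h1 : slopes d M i < slopes d M (i + 1))
    (h2 : slopes d M (i + 2) < slopes d M (i + 1)) :
    slopes d M (i + 1) * (z (i + 1) - z i) < F (z (i + 1)) - F (z i) := by
  have hs := h.step i hi
  rw [slopes_succ hi] at h1 h2 ⊢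
  have hl : (i = 0 ∧ F (z i) - ε / 4 ≤ v i) ∨ F (z i) + 3 * ε / 4 ≤ v i := by
    rcases Nat.eq_zero_or_pos i with rfl | h0
    · exact Or.inl ⟨rfl, by rw [h.left_eq]; linarith [h.left_le]⟩
    · obtain ⟨j, rfl⟩ : ∃ j, i = j + 1 := ⟨i - 1, by omega⟩
      rw [slopes_succ (by omega)] at h1
      exact Or.inr (h.bend_up j hi h1)
  have hr : (i + 1 = M ∧ v (i + 1) ≤ F (z (i + 1)) + ε / 4) ∨
      v (i + 1) ≤ F (z (i + 1)) - 3 * ε / 4 := by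
    rcases (show i + 1 ≤ M from hi).eq_or_lt with h0 | h0
    · exact Or.inl ⟨h0, by rw [h0, h.right_eq]; linarith [h.right_ge]⟩
    · rw [slopes_succ h0] at h2
      exact Or.inr (h.bend_down i h0 h2)
  rcases hl with ⟨hl0, hl⟩ | hl <;> rcases hr with ⟨hr0, hr⟩ | hr
  · omega
  all_goals linarith

/-- On a locally minimal piece the average of the density is below the slope of the string. -/
theorem IsTautShape.mass_lt (h : IsTautShape F ε z v d M) (hε : 0 < ε) {i : ℕ}
    (hi : i < M) (h1 : slopes d M (i + 1) < slopes d M i)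
    (h2 : slopes d M (i + 1) < slopes d M (i + 2)) :
    F (z (i + 1)) - F (z i) < slopes d M (i + 1) * (z (i + 1) - z i) := by
  have hs := h.step i hi
  have hpos := h.slope_pos i hi
  rw [slopes_succ hi] at h1 h2 ⊢
  have h0 : i ≠ 0 := fun h0 => by subst h0; exact absurd hpos (not_lt.2 h1.le)
  have h3 : i + 1 < M := by
    refine lt_of_le_of_ne hi fun h3 => ?_
    rw [show i + 2 = M + 1 by omega, slopes_last] at h2
    exact absurd hpos (not_lt.2 h2.le)
  rw [slopes_succ h3] at h2
  obtain ⟨j, rfl⟩ : ∃ j, i = j + 1 := ⟨i - 1, by omega⟩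
  rw [slopes_succ (by omega)] at h1
  linarith [h.bend_down j hi h1, h.bend_up (j + 1) h3 h2]

end Shape

/-! ### The modality of the taut string is at most that of the density -/

section Modal

variable {k : ℕ} {f : ℝ → ℝ} {t : Fin k → ℝ}

theorem exists_mem_piece_of_notMem_range (ht : Monotone t) {p : ℝ} (hp : p ∉ range t) :
    ∃ j : Fin (k + 1), p ∈ piece t j := by
  classical
  by_cases h : ∃ j, ∃ hj : j < k, p < t ⟨j, hj⟩
  · obtain ⟨hj, hpj⟩ := Nat.find_spec h
    refine ⟨⟨Nat.find h, by omega⟩, fun i => ⟨fun hi => ?_, fun hi => ?_⟩⟩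
    · have := Nat.find_min h hi
      push Not at this
      exact lt_of_le_of_ne (this i.2) fun he => hp ⟨i, he⟩
    · exact hpj.trans_le (ht hi)
  · push Not at h
    refine ⟨Fin.last k, fun i => ⟨fun _ => ?_, fun hi => ?_⟩⟩
    · exact lt_of_le_of_ne (h i i.2) fun he => hp ⟨i, he⟩
    · simp at hi; omega

theorem piece_le_of_lt {p p' : ℝ} (h : p < p') {j j' : Fin (k + 1)} (hp : p ∈ piece t j)
    (hp' : p' ∈ piece t j') : (j : ℕ) ≤ j' := by
  by_contra hlt
  rw [not_le] at hlt
  have hj' : (j' : ℕ) < k := by omega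
  exact lt_asymm h (((hp' ⟨j', hj'⟩).2 le_rfl).trans ((hp ⟨j', hj'⟩).1 hlt))

/-- A strict ascent of `f` leaves the odd pieces. -/
theorem Alternates.succ_le_of_lt (ha : Alternates f t) {p p' : ℝ} (h : p < p')
    {j j' : Fin (k + 1)} (hp : p ∈ piece t j) (hp' : p' ∈ piece t j') (hf : f p < f p')
    (hodd : Odd (j : ℕ)) : (j : ℕ) + 1 ≤ j' := by
  refine (piece_le_of_lt h hp hp').lt_of_ne fun he => ?_
  have : j = j' := Fin.ext he
  subst this
  exact absurd hf (not_lt.2 ((ha j).2 hodd hp hp' h.le))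

/-- A strict descent of `f` leaves the even pieces. -/
theorem Alternates.succ_le_of_gt (ha : Alternates f t) {p p' : ℝ} (h : p < p')
    {j j' : Fin (k + 1)} (hp : p ∈ piece t j) (hp' : p' ∈ piece t j') (hf : f p' < f p)
    (heven : Even (j : ℕ)) : (j : ℕ) + 1 ≤ j' := by
  refine (piece_le_of_lt h hp hp').lt_of_ne fun he => ?_
  have : j = j' := Fin.ext he
  subst this
  exact absurd hf (not_lt.2 ((ha j).1 heven hp hp' h.le))

theorem IsDensity.exists_gt (hf : IsDensity f) {B : Set ℝ} (hB : B.Finite) {u w c : ℝ}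
    (huw : u < w) (h : c * (w - u) < distFun f w - distFun f u) :
    ∃ p ∈ Ioo u w, p ∉ B ∧ c < f p := by
  by_contra hcon
  push Not at hcon
  refine absurd h (not_lt.2 ?_)
  rw [hf.distFun_sub]
  have hle : ∫ y in u..w, f y ≤ ∫ _ in u..w, c := by
    refine intervalIntegral.integral_mono_ae_restrict huw.le hf.integrable.intervalIntegrable
      intervalIntegrable_const ?_
    have hfin : (insert u (insert w B)).Finite := (hB.insert w).insert u
    have hnull : ∀ᵐ y ∂volume.restrict (Icc u w), y ∉ insert u (insert w B) :=
      ae_restrict_of_ae (hfin.countable.ae_notMem volume)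
    filter_upwards [hnull, ae_restrict_mem measurableSet_Icc] with y hy hy'
    simp only [mem_insert_iff, not_or] at hy
    exact hcon y ⟨lt_of_le_of_ne hy'.1 (Ne.symm hy.1), lt_of_le_of_ne hy'.2 hy.2.1⟩ hy.2.2
  rwa [intervalIntegral.integral_const, smul_eq_mul, mul_comm] at hle

theorem IsDensity.exists_lt (hf : IsDensity f) {B : Set ℝ} (hB : B.Finite) {u w c : ℝ}
    (huw : u < w) (h : distFun f w - distFun f u < c * (w - u)) :
    ∃ p ∈ Ioo u w, p ∉ B ∧ f p < c := by
  by_contra hcon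
  push Not at hcon
  refine absurd h (not_lt.2 ?_)
  rw [hf.distFun_sub]
  have hle : ∫ _ in u..w, c ≤ ∫ y in u..w, f y := by
    refine intervalIntegral.integral_mono_ae_restrict huw.le intervalIntegrable_const
      hf.integrable.intervalIntegrable ?_
    have hfin : (insert u (insert w B)).Finite := (hB.insert w).insert u
    have hnull : ∀ᵐ y ∂volume.restrict (Icc u w), y ∉ insert u (insert w B) :=
      ae_restrict_of_ae (hfin.countable.ae_notMem volume)
    filter_upwards [hnull, ae_restrict_mem measurableSet_Icc] with y hy hy'
    simp only [mem_insert_iff, not_or] at hy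
    exact hcon y ⟨lt_of_le_of_ne hy'.1 (Ne.symm hy.1), lt_of_le_of_ne hy'.2 hy.2.1⟩ hy.2.2
  rwa [intervalIntegral.integral_const, smul_eq_mul, mul_comm] at hle

/-- A density cannot be positive and nondecreasing near `+∞`. -/
theorem IsDensity.not_even_last (hf : IsDensity f) (ha : Alternates f t) {p : ℝ}
    (hp : p ∈ piece t (Fin.last k)) (hpos : 0 < f p) : ¬ Even k := by
  intro heven
  have hmono := (ha (Fin.last k)).1 (by simpa using heven)
  have hup : ∀ y, p ≤ y → f p ≤ f y := fun y hy => hmono hp (fun i =>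
    ⟨fun hi => ((hp i).1 hi).trans_le hy, fun hi => by simp at hi; omega⟩) hy
  have hlt : p < p + 2 / f p := by linarith [div_pos two_pos hpos]
  by_cases hinc : distFun f (p + 2 / f p) - distFun f p < f p * (p + 2 / f p - p)
  · obtain ⟨q, hq, -, hlt⟩ := hf.exists_lt finite_empty hlt hinc
    exact absurd (hup q hq.1.le) (not_le.2 hlt)
  · rw [add_sub_cancel_left, mul_div_cancel₀ _ hpos.ne'] at hinc
    linarith [hf.distFun_le_one (p + 2 / f p), hf.distFun_nonneg p]

open Classical in
/-- The extreme indices of `e` below `i`. -/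
def extremeIndices (e : ℕ → ℝ) (i : ℕ) : Finset ℕ :=
  (Finset.range i).filter (IsExtremeIndex e)

variable {ε : ℝ} {z v d : ℕ → ℝ} {M : ℕ}

theorem card_extremeIndices_succ (e : ℕ → ℝ) (i : ℕ) [Decidable (IsExtremeIndex e i)] :
    (extremeIndices e (i + 1)).card
      = (extremeIndices e i).card + if IsExtremeIndex e i then 1 else 0 := by
  classical
  unfold extremeIndices
  rw [Finset.range_add_one, Finset.filter_insert]
  split_ifs with h
  · rw [Finset.card_insert_of_notMem (by simp)]
  · simp

/-- Counting extreme pieces from the left, the density keeps pace: after `N ≥ 1` of them some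
value of the density at a point of its `(N - 1)`-st piece or later lies beyond the current
slope. -/
theorem IsTautShape.extremeIndices_invariant (h : IsTautShape (distFun f) ε z v d M)
    (hε : 0 < ε) (hM : 2 ≤ M) (hf : IsDensity f) (ht : Monotone t) (ha : Alternates f t) :
    ∀ i ≤ M, (Even (extremeIndices (slopes d M) i).card ↔ slopes d M i < slopes d M (i + 1)) ∧
      (1 ≤ (extremeIndices (slopes d M) i).card → ∃ p < z i, ∃ j : Fin (k + 1), p ∈ piece t j ∧
        (extremeIndices (slopes d M) i).card ≤ j + 1 ∧
        (Odd (extremeIndices (slopes d M) i).card → slopes d M i < f p) ∧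
        (Even (extremeIndices (slopes d M) i).card → f p < slopes d M i)) := by
  classical
  intro i
  set e := slopes d M with he
  induction i with
  | zero =>
    intro _
    have h0 : (extremeIndices e 0).card = 0 := by simp [extremeIndices]
    refine ⟨?_, fun h1 => by omega⟩
    rw [h0]
    refine iff_of_true (by decide) ?_
    rw [he, slopes_succ h.pos]
    exact h.slope_pos 0 h.pos
  | succ i ih =>
    intro hi
    obtain ⟨ih1, ih2⟩ := ih (by omega)
    have hne1 := h.slopes_ne i (by omega)
    have hne2 := h.slopes_ne (i + 1) hi
    rw [← he] at hne1 hne2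
    have hzlt : z i < z (i + 1) := h.strictMono i.lt_succ_self
    rw [card_extremeIndices_succ]
    set N := (extremeIndices e i).card with hN
    by_cases hext : IsExtremeIndex e i
    · rw [if_pos hext]
      rcases Nat.even_or_odd N with hev | hodd
      · have h1 : e i < e (i + 1) := ih1.1 hev
        have h2 : e (i + 2) < e (i + 1) := by
          rcases hext with hext | hext
          · exact hext.2
          · exact absurd h1 (not_lt.2 hext.1.le)
        have hN1 : Odd (N + 1) := hev.add_one
        refine ⟨iff_of_false (Nat.not_even_iff_odd.2 hN1) (not_lt.2 h2.le), fun _ => ?_⟩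
        obtain ⟨q, hq, hqt, hqf⟩ := hf.exists_gt (finite_range t) hzlt
          (h.mass_gt hε hM (by omega) h1 h2)
        obtain ⟨j', hj'⟩ := exists_mem_piece_of_notMem_range ht hqt
        refine ⟨q, hq.2, j', hj', ?_, fun _ => hqf,
          fun hcon => absurd hcon (Nat.not_even_iff_odd.2 hN1)⟩
        rcases Nat.eq_zero_or_pos N with h0 | h0
        · omega
        · obtain ⟨p, hp, j, hj, hNj, -, hpf⟩ := ih2 h0
          have hpq : p < q := hp.trans hq.1
          have hjj' := piece_le_of_lt hpq hj hj'
          rcases hNj.lt_or_eq with h3 | h3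
          · omega
          · have := ha.succ_le_of_lt hpq hj hj' ((hpf hev).trans (h1.trans hqf)) (by
              rw [h3, Nat.even_add_one, Nat.not_even_iff_odd] at hev
              exact hev)
            omega
      · have h1 : e (i + 1) < e i :=
          lt_of_le_of_ne (not_lt.1 fun hlt => Nat.not_even_iff_odd.2 hodd (ih1.2 hlt)) hne1.symm
        have h2 : e (i + 1) < e (i + 2) := by
          rcases hext with hext | hext
          · exact absurd h1 (not_lt.2 hext.1.le)
          · exact hext.2
        have hN1 : Even (N + 1) := hodd.add_one
        refine ⟨iff_of_true hN1 h2, fun _ => ?_⟩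
        obtain ⟨q, hq, hqt, hqf⟩ := hf.exists_lt (finite_range t) hzlt
          (h.mass_lt hε (by omega) h1 h2)
        obtain ⟨j', hj'⟩ := exists_mem_piece_of_notMem_range ht hqt
        refine ⟨q, hq.2, j', hj', ?_, fun hcon => absurd hN1 (Nat.not_even_iff_odd.2 hcon),
          fun _ => hqf⟩
        obtain ⟨p, hp, j, hj, hNj, hpf, -⟩ := ih2 hodd.pos
        have hpq : p < q := hp.trans hq.1
        have hjj' := piece_le_of_lt hpq hj hj'
        rcases hNj.lt_or_eq with h3 | h3
        · omega
        · have := ha.succ_le_of_gt hpq hj hj' (hqf.trans (h1.trans (hpf hodd))) (by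
            rw [h3, Nat.odd_add_one, Nat.not_odd_iff_even] at hodd
            exact hodd)
          omega
    · rw [if_neg hext, add_zero]
      unfold IsExtremeIndex at hext
      rw [not_or, not_and, not_and] at hext
      rcases Nat.even_or_odd N with hev | hodd
      · have h1 : e i < e (i + 1) := ih1.1 hev
        refine ⟨iff_of_true hev (lt_of_le_of_ne (not_lt.1 (hext.1 h1)) hne2), fun h0 => ?_⟩
        obtain ⟨p, hp, j, hj, hNj, -, hpf⟩ := ih2 h0
        exact ⟨p, hp.trans hzlt, j, hj, hNj,
          fun hcon => absurd hev (Nat.not_even_iff_odd.2 hcon), fun _ => (hpf hev).trans h1⟩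
      · have h1 : e (i + 1) < e i :=
          lt_of_le_of_ne (not_lt.1 fun hlt => Nat.not_even_iff_odd.2 hodd (ih1.2 hlt)) hne1.symm
        refine ⟨iff_of_false (Nat.not_even_iff_odd.2 hodd) (hext.2 h1), fun h0 => ?_⟩
        obtain ⟨p, hp, j, hj, hNj, hpf, -⟩ := ih2 h0
        exact ⟨p, hp.trans hzlt, j, hj, hNj, fun _ => h1.trans (hpf hodd),
          fun hcon => absurd hcon (Nat.not_even_iff_odd.2 hodd)⟩

/-- The taut string has at most as many extreme pieces as the density has local extremes. -/
theorem IsTautShape.card_extremeIndices_le (h : IsTautShape (distFun f) ε z v d M)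
    (hε : 0 < ε) (hε1 : ε < 1) (hf : IsDensity f) (ht : Monotone t) (ha : Alternates f t) :
    (extremeIndices (slopes d M) M).card ≤ k := by
  classical
  have hpos := h.pos
  rcases (show M = 1 ∨ 2 ≤ M by omega) with hM | hM
  · have hcard : (extremeIndices (slopes d M) M).card ≤ 1 := by
      unfold extremeIndices
      exact (Finset.card_filter_le _ _).trans (by rw [Finset.card_range, hM])
    rcases Nat.eq_zero_or_pos k with hk | hk
    · have hz : z 0 < z M := h.strictMono hpos
      obtain ⟨p, -, hpt, hpf⟩ := hf.exists_gt (finite_range t) (c := 0) hz (by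
        linarith [h.left_le, h.right_ge])
      obtain ⟨j, hj⟩ := exists_mem_piece_of_notMem_range ht hpt
      have hjl : j = Fin.last k := Fin.ext (by rw [Fin.val_last]; omega)
      subst hjl
      exact absurd (by rw [hk]; decide) (hf.not_even_last ha hj hpf)
    · omega
  · obtain ⟨h1, h2⟩ := h.extremeIndices_invariant hε hM hf ht ha M le_rfl
    set N := (extremeIndices (slopes d M) M).card with hN
    have hodd : Odd N := by
      rw [← Nat.not_even_iff_odd, h1, slopes_last]
      exact not_lt.2 (h.slopes_nonneg M)
    obtain ⟨p, -, j, hj, hNj, hpf, -⟩ := h2 hodd.pos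
    by_contra hcon
    have hjk : (j : ℕ) = k := by omega
    have hjl : j = Fin.last k := Fin.ext (by rw [Fin.val_last]; exact hjk)
    subst hjl
    refine hf.not_even_last ha hj ((h.slopes_nonneg M).trans_lt (hpf hodd)) ?_
    have hNk : N = k + 1 := by rw [hjk] at hNj; omega
    rw [hNk, Nat.odd_add_one, Nat.not_odd_iff_even] at hodd
    exact hodd

end Modal

/-! ### Every local extreme of the density is seen by the taut string -/

/-- Over three consecutive intervals in `(τ - ρ, τ + ρ)` the increments of `G` have slopes below,
above and below `c`. -/
def HasBump (G : ℝ → ℝ) (τ ρ : ℝ) : Prop :=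
  ∃ α₁ α₂ β₁ β₂ γ₁ γ₂ c : ℝ, τ - ρ < α₁ ∧ α₁ < α₂ ∧ α₂ ≤ β₁ ∧ β₁ < β₂ ∧ β₂ ≤ γ₁ ∧ γ₁ < γ₂ ∧
    γ₂ < τ + ρ ∧ G α₂ - G α₁ < c * (α₂ - α₁) ∧ c * (β₂ - β₁) < G β₂ - G β₁ ∧
    G γ₂ - G γ₁ < c * (γ₂ - γ₁)

theorem HasBump.mono {G : ℝ → ℝ} {τ ρ ρ' : ℝ} (h : HasBump G τ ρ) (hρ : ρ ≤ ρ') :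
    HasBump G τ ρ' := by
  obtain ⟨α₁, α₂, β₁, β₂, γ₁, γ₂, c, h1, h2, h3, h4, h5, h6, h7, h8⟩ := h
  exact ⟨α₁, α₂, β₁, β₂, γ₁, γ₂, c, by linarith, h2, h3, h4, h5, h6, by linarith, h8⟩

/-- Bumps are stable under uniform perturbations. -/
theorem HasBump.eventually {F : ℝ → ℝ} {τ ρ : ℝ} (h : HasBump F τ ρ) :
    ∀ᶠ η in 𝓝[>] (0 : ℝ), ∀ G : ℝ → ℝ, (∀ y, |G y - F y| ≤ η) → HasBump G τ ρ := by
  obtain ⟨α₁, α₂, β₁, β₂, γ₁, γ₂, c, h1, h2, h3, h4, h5, h6, h7, h8, h9, h10⟩ := h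
  have hlim : Tendsto (fun η : ℝ => 2 * η) (𝓝[>] 0) (𝓝 0) := by
    have : Tendsto (fun η : ℝ => 2 * η) (𝓝 0) (𝓝 (2 * 0)) := (continuous_const_mul 2).tendsto 0
    rw [mul_zero] at this
    exact this.mono_left nhdsWithin_le_nhds
  filter_upwards [hlim.eventually (eventually_lt_nhds (sub_pos.2 h8)),
    hlim.eventually (eventually_lt_nhds (sub_pos.2 h9)),
    hlim.eventually (eventually_lt_nhds (sub_pos.2 h10))] with η e1 e2 e3 G hG
  have a := fun y => abs_le.1 (hG y)
  exact ⟨α₁, α₂, β₁, β₂, γ₁, γ₂, c, h1, h2, h3, h4, h5, h6, h7,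
    by linarith [(a α₁).1, (a α₂).2], by linarith [(a β₁).2, (a β₂).1],
    by linarith [(a γ₁).1, (a γ₂).2]⟩

theorem const_mul_le_integral {g : ℝ → ℝ} (hg : Integrable g) {u w c : ℝ} (huw : u ≤ w)
    (h : ∀ y ∈ Ioo u w, c ≤ g y) : c * (w - u) ≤ ∫ y in u..w, g y := by
  have := intervalIntegral.integral_mono_on_of_le_Ioo (μ := volume) huw
    (intervalIntegrable_const (c := c)) hg.intervalIntegrable h
  rwa [intervalIntegral.integral_const, smul_eq_mul, mul_comm] at this

theorem integral_le_const_mul {g : ℝ → ℝ} (hg : Integrable g) {u w c : ℝ} (huw : u ≤ w)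
    (h : ∀ y ∈ Ioo u w, g y ≤ c) : ∫ y in u..w, g y ≤ c * (w - u) := by
  have := intervalIntegral.integral_mono_on_of_le_Ioo (μ := volume) huw
    hg.intervalIntegrable (intervalIntegrable_const (c := c)) h
  rwa [intervalIntegral.integral_const, smul_eq_mul, mul_comm c] at *

/-- A local maximum located at a single point makes a bump in the primitive at every scale. -/
theorem hasBump_of_isolated {g G : ℝ → ℝ} (hg : Integrable g)
    (hG : ∀ u w, G w - G u = ∫ y in u..w, g y) {τ ρ : ℝ} (hρ : 0 < ρ)
    (hl : MonotoneOn g (Ioo (τ - ρ) τ)) (hr : AntitoneOn g (Ioo τ (τ + ρ)))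
    (hiso : ∀ᶠ x in 𝓝[≠] τ, ∃ᶠ y in 𝓝[≠] τ, g x < g y) : HasBump G τ ρ := by
  obtain ⟨η, hη, hηs⟩ := Metric.mem_nhdsWithin_iff.1 hiso
  have hiso' : ∀ x, x ≠ τ → |x - τ| < η → ∃ᶠ y in 𝓝[≠] τ, g x < g y := fun x hx hxη =>
    hηs ⟨by rwa [Metric.mem_ball, Real.dist_eq], hx⟩
  set h := min η ρ / 3 with hh
  have hpos : 0 < h := by positivity
  have h1 : h < η := by linarith [min_le_left η ρ]
  have h2 : 3 * h ≤ ρ := by linarith [min_le_right η ρ]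
  -- Some value near `τ` exceeds the values at distance `h` on both sides.
  obtain ⟨y, hyτ, hyh, hy1, hy2⟩ : ∃ y, y ≠ τ ∧ |y - τ| < h ∧ g (τ - h) < g y ∧ g (τ + h) < g y := by
    have hnear : ∀ᶠ y in 𝓝[≠] τ, |y - τ| < h := by
      refine mem_nhdsWithin_of_mem_nhds (mem_of_superset (Metric.ball_mem_nhds τ hpos) ?_)
      intro y hy; rwa [Metric.mem_ball, Real.dist_eq] at hy
    have e1 := hiso' (τ - h) (by linarith) (by
      rw [sub_sub_cancel_left, abs_neg, abs_of_pos hpos]; exact h1)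
    have e2 := hiso' (τ + h) (by linarith) (by rw [add_sub_cancel_left, abs_of_pos hpos]; exact h1)
    rcases le_total (g (τ - h)) (g (τ + h)) with hle | hle
    · obtain ⟨y, hy, hy1, hy2⟩ := (e2.and_eventually (hnear.and self_mem_nhdsWithin)).exists
      exact ⟨y, hy2, hy1, hle.trans_lt hy, hy⟩
    · obtain ⟨y, hy, hy1, hy2⟩ := (e1.and_eventually (hnear.and self_mem_nhdsWithin)).exists
      exact ⟨y, hy2, hy1, hy, hle.trans_lt hy⟩
  rw [abs_lt] at hyh
  set m := max (g (τ - h)) (g (τ + h)) with hm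
  have hmy : m < g y := max_lt hy1 hy2
  have hA : G (τ - h) - G (τ - 2 * h) < (m + g y) / 2 * (τ - h - (τ - 2 * h)) := by
    rw [hG]
    refine (integral_le_const_mul hg (by linarith) (c := m) fun w hw => ?_).trans_lt ?_
    · exact (hl ⟨by linarith [hw.1], by linarith [hw.2]⟩ ⟨by linarith, by linarith⟩ hw.2.le).trans
        (le_max_left _ _)
    · exact mul_lt_mul_of_pos_right (by linarith) (by linarith)
  have hD : G (τ + 2 * h) - G (τ + h) < (m + g y) / 2 * (τ + 2 * h - (τ + h)) := by
    rw [hG]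
    refine (integral_le_const_mul hg (by linarith) (c := m) fun w hw => ?_).trans_lt ?_
    · exact (hr ⟨by linarith, by linarith⟩ ⟨by linarith [hw.1], by linarith [hw.2]⟩ hw.1.le).trans
        (le_max_right _ _)
    · exact mul_lt_mul_of_pos_right (by linarith) (by linarith)
  rcases lt_or_gt_of_ne hyτ with hlt | hgt
  · refine ⟨τ - 2 * h, τ - h, y, τ, τ + h, τ + 2 * h, (m + g y) / 2, by linarith, by linarith,
      by linarith, hlt, by linarith, by linarith, by linarith, hA, ?_, hD⟩
    rw [hG]
    refine lt_of_lt_of_le ?_ (const_mul_le_integral hg hlt.le (c := g y) fun w hw => ?_)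
    · exact mul_lt_mul_of_pos_right (by linarith) (by linarith)
    · exact hl ⟨by linarith, hlt⟩ ⟨by linarith [hw.1], hw.2⟩ hw.1.le
  · refine ⟨τ - 2 * h, τ - h, τ, y, τ + h, τ + 2 * h, (m + g y) / 2, by linarith, by linarith,
      by linarith, hgt, by linarith, by linarith, by linarith, hA, ?_, hD⟩
    rw [hG]
    refine lt_of_lt_of_le ?_ (const_mul_le_integral hg hgt.le (c := g y) fun w hw => ?_)
    · exact mul_lt_mul_of_pos_right (by linarith) (by linarith)
    · exact hr ⟨hw.1, by linarith [hw.2]⟩ ⟨hgt, by linarith⟩ hw.2.le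

section Windows

variable {k : ℕ} {f : ℝ → ℝ} {t : Fin k → ℝ}

/-- A radius at which the extremes are separated. -/
theorem exists_separation (ht : StrictMono t) {δ : ℝ} (hδ : 0 < δ) :
    ∃ ρ, 0 < ρ ∧ ρ ≤ δ ∧ ∀ i j, i < j → t i + 2 * ρ ≤ t j := by
  have hev : ∀ i j, i < j → ∀ᶠ ρ in 𝓝[>] (0 : ℝ), t i + 2 * ρ ≤ t j := fun i j hij => by
    have : Tendsto (fun ρ : ℝ => t i + 2 * ρ) (𝓝 0) (𝓝 (t i + 2 * 0)) :=
      (continuous_const.add (continuous_const_mul 2)).tendsto 0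
    rw [mul_zero, add_zero] at this
    exact ((this.mono_left nhdsWithin_le_nhds).eventually (eventually_lt_nhds (ht hij))).mono
      fun _ h => h.le
  have hall : ∀ᶠ ρ in 𝓝[>] (0 : ℝ), ∀ i j, i < j → t i + 2 * ρ ≤ t j :=
    eventually_all.2 fun i => eventually_all.2 fun j => by
      by_cases hij : i < j
      · exact (hev i j hij).mono fun _ h _ => h
      · exact Eventually.of_forall fun _ h => absurd h hij
  obtain ⟨ρ, h1, h2⟩ := (hall.and (Ioc_mem_nhdsGT hδ)).exists
  exact ⟨ρ, h2.1, h2.2, h1⟩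

theorem Ioo_left_subset_piece {ρ : ℝ} (hsep : ∀ i j : Fin k, i < j → t i + 2 * ρ ≤ t j)
    (hρ : 0 < ρ) (i : Fin k) : Ioo (t i - ρ) (t i) ⊆ piece t i.castSucc := by
  intro y hy l
  refine ⟨fun hl => ?_, fun hl => ?_⟩
  · have := hsep l i hl
    linarith [hy.1]
  · rcases (Fin.le_def.2 hl : i ≤ l).eq_or_lt with rfl | h
    · exact hy.2
    · linarith [hsep i l h, hy.2]

theorem Ioo_right_subset_piece {ρ : ℝ} (hsep : ∀ i j : Fin k, i < j → t i + 2 * ρ ≤ t j)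
    (hρ : 0 < ρ) (i : Fin k) : Ioo (t i) (t i + ρ) ⊆ piece t i.succ := by
  intro y hy l
  rw [Fin.val_succ]
  refine ⟨fun hl => ?_, fun hl => ?_⟩
  · rcases (Fin.le_def.2 (Nat.lt_succ_iff.1 hl) : l ≤ i).eq_or_lt with rfl | h
    · exact hy.1
    · linarith [hsep l i h, hy.1]
  · linarith [hsep i l (Fin.lt_def.2 hl), hy.2]

theorem IsModal.hasBump (hmod : IsModal f t) (hf : IsDensity f) {ρ : ℝ} (hρ : 0 < ρ)
    (hsep : ∀ i j : Fin k, i < j → t i + 2 * ρ ≤ t j) (i : Fin k) :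
    HasBump (distFun f) (t i) ρ ∨ HasBump (fun y => -distFun f y) (t i) ρ := by
  have hl := hmod.alternates i.castSucc
  have hr := hmod.alternates i.succ
  rw [Fin.val_castSucc] at hl
  rw [Fin.val_succ] at hr
  have hls := Ioo_left_subset_piece hsep hρ i
  have hrs := Ioo_right_subset_piece hsep hρ i
  rcases Nat.even_or_odd (i : ℕ) with h | h
  · exact Or.inl (hasBump_of_isolated hf.integrable hf.distFun_sub hρ ((hl.1 h).mono hls)
      ((hr.2 h.add_one).mono hrs) (hmod.isolated_max i h))
  · refine Or.inr (hasBump_of_isolated hf.integrable.neg (fun u w => ?_) hρ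
      ((hl.2 h).mono hls).neg ((hr.1 h.add_one).mono hrs).neg ?_)
    · simp only [Pi.neg_apply, intervalIntegral.integral_neg, ← hf.distFun_sub]; ring
    · filter_upwards [hmod.isolated_min i h] with x hx
      exact hx.mono fun y hy => neg_lt_neg hy

/-- Between two values below `c` that enclose a value above `c` there is a local extremum. -/
theorem exists_extremeIndex {e : ℕ → ℝ} {M : ℕ} (he : ∀ i ≤ M, e i ≠ e (i + 1)) {a b a' : ℕ}
    (hab : a ≤ b) (hba : b ≤ a') (ha' : a' ≤ M + 1) {c : ℝ} (h1 : e a < c) (h2 : c < e b)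
    (h3 : e a' < c) : ∃ J < M, a < J + 1 ∧ J + 1 < a' ∧ IsExtremeIndex e J := by
  obtain ⟨i, hi, hmax⟩ := (Finset.Icc a a').exists_max_image e
    ⟨b, Finset.mem_Icc.2 ⟨hab, hba⟩⟩
  have hbi := hmax b (Finset.mem_Icc.2 ⟨hab, hba⟩)
  rw [Finset.mem_Icc] at hi
  have hai : a < i := lt_of_le_of_ne hi.1 fun h => by subst h; linarith
  have hia : i < a' := lt_of_le_of_ne hi.2 fun h => by subst h; linarith
  obtain ⟨J, rfl⟩ : ∃ J, i = J + 1 := ⟨i - 1, by omega⟩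
  refine ⟨J, by omega, hai, hia, Or.inl ⟨?_, ?_⟩⟩
  · exact lt_of_le_of_ne (hmax J (Finset.mem_Icc.2 ⟨by omega, by omega⟩)) (he J (by omega))
  · exact lt_of_le_of_ne (hmax (J + 2) (Finset.mem_Icc.2 ⟨by omega, by omega⟩))
      (he (J + 1) (by omega)).symm

variable {F : ℝ → ℝ} {ε : ℝ} {z v d : ℕ → ℝ} {M : ℕ}

theorem mem_Ioo_of_knotIndex_lt {J : ℕ} {y y' w : ℝ} (h1 : knotIndex z M y < J)
    (h2 : J < knotIndex z M y') (hw : knotIndex z M w = J) : w ∈ Ioo y y' :=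
  ⟨knotIndex_mono.reflect_lt (h1.trans_eq hw.symm), knotIndex_mono.reflect_lt (hw.trans_lt h2)⟩

theorem IsTautShape.exists_extreme_of_bump (h : IsTautShape F ε z v d M) {τ ρ : ℝ}
    (hb : HasBump (interp z v M) τ ρ ∨ HasBump (fun y => -interp z v M y) τ ρ) :
    ∃ J < M, IsExtremeIndex (slopes d M) J ∧
      knotIndex z M ⁻¹' {J + 1} ⊆ Ioo (τ - ρ) (τ + ρ) := by
  have hmono : Monotone (interp z v M) := monotone_interp h.strictMono fun i hi => by
    rw [h.step i hi]
    have := mul_nonneg (h.slope_pos i hi).le (sub_nonneg.2 (h.strictMono.monotone i.le_succ))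
    linarith
  rcases hb with ⟨α₁, α₂, β₁, β₂, γ₁, γ₂, c, h1, h2, h3, h4, h5, h6, h7, h8, h9, h10⟩ |
    ⟨α₁, α₂, β₁, β₂, γ₁, γ₂, c, h1, h2, h3, h4, h5, h6, h7, h8, h9, h10⟩
  · have hc : 0 < c := pos_of_mul_pos_left
      ((sub_nonneg.2 (hmono h2.le)).trans_lt h8) (sub_pos.2 h2).le
    obtain ⟨y₁, hy₁, e₁⟩ := h.exists_slope_lt h2 hc h8
    obtain ⟨y₂, hy₂, e₂⟩ := h.exists_slope_gt h4 hc.le h9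
    obtain ⟨y₃, hy₃, e₃⟩ := h.exists_slope_lt h6 hc h10
    obtain ⟨J, hJ, hJ1, hJ2, hJe⟩ := exists_extremeIndex h.slopes_ne
      (knotIndex_mono (by linarith [hy₁.2, hy₂.1])) (knotIndex_mono (by linarith [hy₂.2, hy₃.1]))
      (knotIndex_le y₃) e₁ e₂ e₃
    refine ⟨J, hJ, hJe, fun w hw => ?_⟩
    have := mem_Ioo_of_knotIndex_lt hJ1 hJ2 hw
    exact ⟨by linarith [this.1, hy₁.1], by linarith [this.2, hy₃.2]⟩
  · have hc : 0 < -c := by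
      refine pos_of_mul_pos_left (b := β₂ - β₁) ?_ (sub_pos.2 h4).le
      linarith [hmono h4.le]
    obtain ⟨y₁, hy₁, e₁⟩ := h.exists_slope_gt h2 hc.le (by linarith)
    obtain ⟨y₂, hy₂, e₂⟩ := h.exists_slope_lt h4 hc (by linarith)
    obtain ⟨y₃, hy₃, e₃⟩ := h.exists_slope_gt h6 hc.le (by linarith)
    obtain ⟨J, hJ, hJ1, hJ2, hJe⟩ := exists_extremeIndex (e := fun j => -slopes d M j) (c := c)
      (a := knotIndex z M y₁) (b := knotIndex z M y₂) (a' := knotIndex z M y₃)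
      (fun i hi he => h.slopes_ne i hi (neg_injective he))
      (knotIndex_mono (by linarith [hy₁.2, hy₂.1])) (knotIndex_mono (by linarith [hy₂.2, hy₃.1]))
      (knotIndex_le y₃) (by linarith) (by linarith) (by linarith)
    refine ⟨J, hJ, (isExtremeIndex_neg _ _).1 hJe, fun w hw => ?_⟩
    have := mem_Ioo_of_knotIndex_lt hJ1 hJ2 hw
    exact ⟨by linarith [this.1, hy₁.1], by linarith [this.2, hy₃.2]⟩

end Windows

/-! ### Locating the extremes -/

section Main

variable {k : ℕ} {f : ℝ → ℝ} {t : Fin k → ℝ}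

theorem locatesExtremes_of_shape {ε : ℝ} {z v d : ℕ → ℝ} {M : ℕ} {s : ℝ → ℝ}
    (h : IsTautShape (distFun f) ε z v d M) (hs : ∀ y, s y = slopes d M (knotIndex z M y))
    (hcard : (extremeIndices (slopes d M) M).card ≤ k) {ρ δ : ℝ} (hρδ : 2 * ρ ≤ δ)
    (hsep : ∀ i j : Fin k, i < j → t i + 2 * ρ ≤ t j)
    (hloc : ∀ i : Fin k, ∃ J < M, IsExtremeIndex (slopes d M) J ∧
      knotIndex z M ⁻¹' {J + 1} ⊆ Ioo (t i - ρ) (t i + ρ)) :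
    LocatesExtremes s t δ := by
  classical
  choose φ hφM hφe hφs using hloc
  set I : Fin k → Set ℝ := fun i => knotIndex z M ⁻¹' {φ i + 1} with hI
  have hord : ∀ i j, i < j → ∀ x ∈ I i, ∀ y ∈ I j, x < y := fun i j hij x hx y hy => by
    linarith [hsep i j hij, (hφs i hx).2, (hφs j hy).1]
  have hne : ∀ i, (I i).Nonempty := fun i =>
    ⟨z (φ i + 1), knotIndex_eq h.strictMono (hφM i) ⟨h.strictMono (Nat.lt_succ_self _), le_rfl⟩⟩
  have hinjI : Function.Injective I := fun i j hij => by
    obtain ⟨w, hw⟩ := hne i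
    have hw' : w ∈ I j := hij ▸ hw
    rcases lt_trichotomy i j with hlt | heq | hlt
    · exact absurd (hord i j hlt w hw w hw') (lt_irrefl w)
    · exact heq
    · exact absurd (hord j i hlt w hw' w hw) (lt_irrefl w)
  have hinj : Function.Injective φ := fun i j hij => hinjI (by simp only [hI, hij])
  have himage : Finset.univ.image φ = extremeIndices (slopes d M) M := by
    refine Finset.eq_of_subset_of_card_le (fun J hJ => ?_) ?_
    · obtain ⟨i, -, rfl⟩ := Finset.mem_image.1 hJ
      unfold extremeIndices
      exact Finset.mem_filter.2 ⟨Finset.mem_range.2 (hφM i), hφe i⟩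
    · rw [Finset.card_image_of_injective _ hinj, Finset.card_univ, Fintype.card_fin]
      exact hcard
  have hrange : range I = extremeIntervals s := by
    ext A
    rw [mem_extremeIntervals_iff h.strictMono hs h.slopes_ne]
    constructor
    · rintro ⟨i, rfl⟩
      exact ⟨φ i, hφM i, hφe i, rfl⟩
    · rintro ⟨J, hJ, hJe, rfl⟩
      have hJmem : J ∈ extremeIndices (slopes d M) M := by
        unfold extremeIndices
        exact Finset.mem_filter.2 ⟨Finset.mem_range.2 hJ, hJe⟩
      rw [← himage] at hJmem
      obtain ⟨i, -, rfl⟩ := Finset.mem_image.1 hJmem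
      exact ⟨i, rfl⟩
  have hinf : ∀ i, t i - ρ ≤ sInf (I i) := fun i => le_csInf (hne i) fun x hx => (hφs i hx).1.le
  have hsup : ∀ i, sSup (I i) ≤ t i + ρ := fun i => csSup_le (hne i) fun x hx => (hφs i hx).2.le
  have hle : ∀ i, sInf (I i) ≤ sSup (I i) := fun i =>
    csInf_le_csSup (hne i) ⟨t i - ρ, fun x hx => (hφs i hx).1.le⟩ ⟨t i + ρ, fun x hx => (hφs i hx).2.le⟩
  refine ⟨?_, ?_, I, hord, hrange, fun i => ?_⟩
  · rw [modality, ← hrange, ← image_univ, hinjI.encard_image, encard_univ]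
    simp
  · rw [← hrange]
    rintro _ ⟨i, rfl⟩
    unfold intervalLength
    linarith [hinf i, hsup i]
  · unfold intervalMid
    rw [abs_le]
    constructor <;> linarith [hinf i, hsup i, hle i]

/-- The deterministic part of the theorem: a sample whose empirical distribution function is
within a quarter of the tube radius of `F` has a taut string that locates the extremes of `f`,
once the radius is small. -/
theorem eventually_tautStringLocates (hf : IsDensity f) (hmod : IsModal f t) {δ : ℝ}
    (hδ : 0 < δ) :
    ∀ᶠ ε in 𝓝[>] (0 : ℝ), ∀ (n : ℕ) (x : Fin n → ℝ),
      (∀ y, |empCDF x y - distFun f y| ≤ ε / 4) → TautStringLocates x ε t δ := by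
  obtain ⟨ρ, hρ, hρδ, hsep⟩ := exists_separation hmod.strictMono (half_pos hδ)
  have hbump : ∀ᶠ η in 𝓝[>] (0 : ℝ), ∀ i : Fin k, ∀ G : ℝ → ℝ,
      (∀ y, |G y - distFun f y| ≤ η) →
        HasBump G (t i) ρ ∨ HasBump (fun y => -G y) (t i) ρ := by
    refine eventually_all.2 fun i => ?_
    rcases hmod.hasBump hf hρ hsep i with hb | hb
    · filter_upwards [hb.eventually] with η hη G hG
      exact Or.inl (hη G hG)
    · filter_upwards [hb.eventually] with η hη G hG
      refine Or.inr (hη _ fun y => ?_)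
      rw [← abs_neg]
      simpa [add_comm, sub_eq_add_neg] using hG y
  have hscale : Tendsto (fun ε : ℝ => 2 * ε) (𝓝[>] 0) (𝓝[>] 0) := by
    refine tendsto_nhdsWithin_iff.2 ⟨?_, ?_⟩
    · have : Tendsto (fun ε : ℝ => 2 * ε) (𝓝 0) (𝓝 (2 * 0)) := (continuous_const_mul 2).tendsto 0
      rw [mul_zero] at this
      exact this.mono_left nhdsWithin_le_nhds
    · filter_upwards [self_mem_nhdsWithin] with ε hε
      exact mul_pos two_pos (mem_Ioi.1 hε)
  filter_upwards [hscale.eventually hbump, Ioo_mem_nhdsGT one_pos] with ε hb hε n x hdev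
  have hFc := hf.continuous_distFun
  have hn := pos_of_deviation hf.tendsto_distFun_atTop hε.2 hdev
  refine ⟨exists_isTautString (sampleMin_lt_sampleMax hFc hn hε.2 hdev)
    (exists_isTubeString hFc hf.monotone_distFun hf.distFun_nonneg hf.distFun_le_one hn hε.1 hε.2
      hdev), fun S hS => ?_⟩
  obtain ⟨M, z, d, hshape, hs⟩ := hS.exists_shape hFc hf.monotone_distFun hf.distFun_nonneg
    hf.distFun_le_one hn hε.1 hε.2 hdev
  refine locatesExtremes_of_shape hshape hs
    (hshape.card_extremeIndices_le hε.1 hε.2 hf hmod.strictMono.monotone hmod.alternates)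
    (ρ := ρ) (by linarith) hsep fun i => ?_
  exact hshape.exists_extreme_of_bump (hb i _ hshape.close)

end Main

end TautString

end

theorem theorem4p1 {Ω : Type*} [MeasurableSpace Ω] (P : Measure Ω) [IsProbabilityMeasure P]
    (k : ℕ) (f : ℝ → ℝ) (t : Fin k → ℝ)
    (hf : TautString.IsDensity f) (hmod : TautString.IsModal f t)
    (hdist : ∃ η > 0, ∀ m < k, ∀ g, TautString.IsDensity g → TautString.AtMostModal m g →
      η ≤ TautString.kolmogorovDist (TautString.distFun f) (TautString.distFun g))
    (X : ℕ → Ω → ℝ) (hX : ∀ i, Measurable (X i)) (hindep : iIndepFun X P)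
    (hlaw : ∀ i, P.map (X i) = volume.withDensity fun x => ENNReal.ofReal (f x))
    (δ : ℝ) (hδ : 0 < δ) :
    Tendsto
      (fun C : ℝ => liminf
        (fun n : ℕ => TautString.innerProb P
          {ω | TautString.TautStringLocates (fun i : Fin n => X i ω) (C / Real.sqrt n) t δ})
        atTop)
      atTop (𝓝 1) := by
  have hlim : Tendsto (fun C : ℝ => 1 - ENNReal.ofReal (10 / ((C - 8) / 40) ^ 4)) atTop (𝓝 1) := by
    have h1 : Tendsto (fun C : ℝ => ((C - 8) / 40) ^ 4) atTop atTop :=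
      (tendsto_pow_atTop (by norm_num)).comp
        ((tendsto_atTop_add_const_right atTop (-8) tendsto_id).atTop_div_const (by norm_num))
    have h2 : Tendsto (fun C : ℝ => ENNReal.ofReal (10 / ((C - 8) / 40) ^ 4)) atTop (𝓝 0) := by
      rw [← ENNReal.ofReal_zero]
      exact (ENNReal.continuous_ofReal.tendsto 0).comp (tendsto_const_nhds.div_atTop h1)
    have h3 := ENNReal.Tendsto.sub (tendsto_const_nhds (x := (1 : ENNReal))) h2
      (Or.inl ENNReal.one_ne_top)
    simpa using h3
  refine tendsto_of_tendsto_of_tendsto_of_le_of_le' hlim tendsto_const_nhds ?_ ?_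
  · filter_upwards [eventually_gt_atTop (8 : ℝ)] with C hC
    refine le_liminf_of_le (by isBoundedDefault) ?_
    have hc : 0 < (C - 8) / 40 := by linarith
    have hε : Tendsto (fun n : ℕ => C / √(n : ℝ)) atTop (𝓝[>] 0) := by
      refine tendsto_nhdsWithin_iff.2 ⟨tendsto_const_nhds.div_atTop
        (Real.tendsto_sqrt_atTop.comp tendsto_natCast_atTop_atTop), ?_⟩
      filter_upwards [eventually_gt_atTop 0] with n hn
      have : (0 : ℝ) < n := by exact_mod_cast hn
      exact div_pos (by linarith) (Real.sqrt_pos.2 this)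
    filter_upwards [hε.eventually (TautString.eventually_tautStringLocates hf hmod hδ),
      eventually_gt_atTop 0] with n hn hn0
    have hsub : {ω | TautString.TautStringLocates (fun i : Fin n => X i ω) (C / √n) t δ}ᶜ ⊆
        {ω | ¬ ∀ y, |TautString.empCDF (fun i : Fin n => X i ω) y - TautString.distFun f y|
          ≤ (10 * ((C - 8) / 40) + 2) / √n} := by
      intro ω hω hdev
      refine hω (hn n _ fun y => (hdev y).trans (le_of_eq ?_))
      -- The constant `(C - 8) / 40` makes the deviation a quarter of the tube radius.
      ring
    exact tsub_le_tsub_left ((measure_mono hsub).trans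
      (TautString.measure_empCDF_deviation_le hf hX hindep hlaw hn0 hc)) 1
  · refine Eventually.of_forall fun C => ?_
    refine (liminf_le_liminf (v := fun _ : ℕ => (1 : ENNReal))
      (Eventually.of_forall fun n => tsub_le_self)).trans ?_
    simp
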